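/- Let $\mathbb S=\{q\in\mathbb H: q^2=-1\}$. Let $\Omega\subseteq\mathbb H$ be a symmetric slice domain, i.e. an open connected set that meets $\mathbb R$, such that $\Omega_I=\Omega\cap(\mathbb R+I\mathbb R)$ is a domain of $\mathbb R+I\mathbb R$ for every $I\in\mathbb S$, and that contains the sphere $x+y\mathbb S$ whenever it contains one of its points $x+Iy$ ($x,y\in\mathbb R$, $I\in\mathbb S$). A function $f:\Omega\to\mathbb H$ is (slice) regular if for every $I\in\mathbb S$ its restriction $f_I$ to $\Omega_I$ is holomorphic, i.e. is $C^1$ with $\tfrac12\left(\frac{\partial}{\partial x}+I\frac{\partial}{\partial y}\right)f_I(x+Iy)=0$. For orthogonal $I,J\in\mathbb S$ write $f_I=F+GJ$ and $g_I=H+KJ$ with $F,G,H,K:\Omega_I\to\mathbb R+I\mathbb R$ holomorphic. The $*$-product $f*g$ and the regular conjugate $f^c$ are the regular functions on $\Omega$ (independent of the choice of $I,J$) with $$(f*g)_I(z)=\left[F(z)H(z)-G(z)\overline{K(\bar z)}\right]+\left[F(z)K(z)+G(z)\overline{H(\bar z)}\right]J,\qquad (f^c)_I(z)=\overline{F(\bar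 z)}-G(z)J.$$ The symmetrization is $f^s=f*f^c=f^c*f$, with zero set $Z_{f^s}\subseteq\Omega$; the regular reciprocal is $f^{-*}=\frac1{f^s}f^c$ on $\Omega\setminus Z_{f^s}$, where it is regular; and $f^{-*}*g$ is the $*$-product on $\Omega\setminus Z_{f^s}$ of $f^{-*}$ with the restriction of $g$, given by the same formulas. (If $f\equiv0$, then $\Omega\setminus Z_{f^s}=\emptyset$ and the claims below about this set are empty.) Proposition. Let $f,g$ be regular functions on a symmetric slice domain $\Omega$. All the functions above are well defined. For $q\in\Omega\setminus Z_{f^s}$ one has $f^c(q)\neq0$, and $T_f(q)=f^c(q)^{-1}\,q\,f^c(q)$ defines a map $T_f:\Omega\setminus Z_{f^s}\to\Omega\setminus Z_{f^s}$. For all $q\in\Omega\setminus Z_{f^s}$, $f(T_f(q))\ne0$ and $$f^{-*}*g(q)=f(T_f(q))^{-1}\cdot g(T_f(q)).$$ Furthermore $Z_{(f^c)^s}=Z_{f^s}$, the maps $T_f$ and $T_{f^c}$ are mutually inverse self-maps of the open set $\Omega\setminus Z_{f^s}$, and both are $C^\infty$, so that $T_f$ is a diffeomorphism of $\Omega\setminus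 Z_{f^s}$ onto itself. -/

import Mathlib

open scoped Quaternion ContDiff

noncomputable section

namespace SliceRegularity

/-- The 2-sphere `𝕊` of quaternionic imaginary units. -/
def imagUnits : Set ℍ := {q | q ^ 2 = -1}

/-- The parametrization `x + i y ↦ x + I y` of the real plane `ℝ + I ℝ`. -/
def sliceMap (I : ℍ) (z : ℂ) : ℍ := (z.re : ℍ) + I * (z.im : ℍ)

/-- The plane `ℝ + I ℝ`. -/
def slicePlane (I : ℍ) : Set ℍ := Set.range (sliceMap I)

/-- The slice `Ω_I = Ω ∩ (ℝ + I ℝ)`. -/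
def slice (Ω : Set ℍ) (I : ℍ) : Set ℍ := Ω ∩ slicePlane I

/-- The restriction of `f` to `Ω_I` is holomorphic: as a function of the real variables `x, y`
with `x + I y ∈ Ω`, it is continuously differentiable and `(1/2) (∂/∂x + I ∂/∂y) f (x + I y) = 0`.
The pair `(x, y)` is encoded as the complex number `x + i y`. -/
def HolomorphicOnSlice (Ω : Set ℍ) (I : ℍ) (f : ℍ → ℍ) : Prop :=
  ContDiffOn ℝ 1 (fun z : ℂ => f (sliceMap I z)) (sliceMap I ⁻¹' Ω) ∧
  ∀ z ∈ sliceMap I ⁻¹' Ω,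
    (1 / 2 : ℝ) • (fderiv ℝ (fun w : ℂ => f (sliceMap I w)) z 1
      + I * fderiv ℝ (fun w : ℂ => f (sliceMap I w)) z Complex.I) = 0

/-- (Slice) regular functions on `Ω`. Only the values of `f` on `Ω` matter when `Ω` is open. -/
def SliceRegular (Ω : Set ℍ) (f : ℍ → ℍ) : Prop :=
  ∀ I ∈ imagUnits, HolomorphicOnSlice Ω I f

/-- Axially symmetric sets: with `x + I y` they contain the whole sphere `x + y 𝕊`. -/
def AxiallySymmetric (T : Set ℍ) : Prop :=
  ∀ x y : ℝ, ∀ I ∈ imagUnits, (x : ℍ) + I * (y : ℍ) ∈ T →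
    ∀ J ∈ imagUnits, (x : ℍ) + J * (y : ℍ) ∈ T

/-- Slice domains: domains of `ℍ` that meet the real axis and whose slices `Ω_I` are domains of
`ℝ + I ℝ` (relative openness of `Ω_I` follows from that of `Ω`). -/
structure IsSliceDomain (Ω : Set ℍ) : Prop where
  isOpen : IsOpen Ω
  isConnected : IsConnected Ω
  meets_real : ∃ r : ℝ, (r : ℍ) ∈ Ω
  slice_isConnected : ∀ I ∈ imagUnits, IsConnected (slice Ω I)

/-- Symmetric slice domains. -/
structure IsSymmetricSliceDomain (Ω : Set ℍ) : Prop extends IsSliceDomain Ω where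
  symmetric : AxiallySymmetric Ω

/-- `f_I = F + G J` on `Ω_I`, with `F, G : Ω_I → ℝ + I ℝ` holomorphic. -/
structure IsSplitting (Ω : Set ℍ) (I J : ℍ) (f F G : ℍ → ℍ) : Prop where
  holo_left : HolomorphicOnSlice Ω I F
  holo_right : HolomorphicOnSlice Ω I G
  mapsTo_left : Set.MapsTo F (slice Ω I) (slicePlane I)
  mapsTo_right : Set.MapsTo G (slice Ω I) (slicePlane I)
  eq_add : ∀ z ∈ slice Ω I, f z = F z + G z * J

/-- `h` is the `*`-product of `f` and `g` on `Ω`: it is regular on `Ω` and, whichever orthogonal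
imaginary units `I, J` are chosen, splitting `f_I = F + G J` and `g_I = H + K J` gives
`h_I(z) = [F(z) H(z) - G(z) conj (K (conj z))] + [F(z) K(z) + G(z) conj (H (conj z))] J`. -/
def IsStarProduct (Ω : Set ℍ) (f g h : ℍ → ℍ) : Prop :=
  SliceRegular Ω h ∧
  ∀ I ∈ imagUnits, ∀ J ∈ imagUnits, inner ℝ I J = 0 →
    ∃ F G H K : ℍ → ℍ, IsSplitting Ω I J f F G ∧ IsSplitting Ω I J g H K ∧
      ∀ z ∈ slice Ω I,
        h z = (F z * H z - G z * star (K (star z))) + (F z * K z + G z * star (H (star z))) * J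

/-- `h` is the regular conjugate of `f` on `Ω`: it is regular on `Ω` and, whichever orthogonal
imaginary units `I, J` are chosen, splitting `f_I = F + G J` gives
`h_I(z) = conj (F (conj z)) - G(z) J`. -/
def IsRegularConj (Ω : Set ℍ) (f h : ℍ → ℍ) : Prop :=
  SliceRegular Ω h ∧
  ∀ I ∈ imagUnits, ∀ J ∈ imagUnits, inner ℝ I J = 0 →
    ∃ F G : ℍ → ℍ, IsSplitting Ω I J f F G ∧
      ∀ z ∈ slice Ω I, h z = star (F (star z)) - G z * J

open Classical in
/-- The `*`-product `f * g` on `Ω`; its values outside `Ω` are irrelevant. -/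
def starProduct (Ω : Set ℍ) (f g : ℍ → ℍ) : ℍ → ℍ :=
  if h : ∃ k, IsStarProduct Ω f g k then h.choose else 0

open Classical in
/-- The regular conjugate `f^c` on `Ω`; its values outside `Ω` are irrelevant. -/
def regularConj (Ω : Set ℍ) (f : ℍ → ℍ) : ℍ → ℍ :=
  if h : ∃ k, IsRegularConj Ω f k then h.choose else 0

/-- The symmetrization `f^s = f * f^c`. -/
def symmetrization (Ω : Set ℍ) (f : ℍ → ℍ) : ℍ → ℍ :=
  starProduct Ω f (regularConj Ω f)

/-- The zero set in `Ω` of a function on `Ω`. -/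
def zeroSet (Ω : Set ℍ) (f : ℍ → ℍ) : Set ℍ := {q ∈ Ω | f q = 0}

/-- The domain `Ω \ Z_{f^s}` of the regular reciprocal of `f`. -/
def reciprocalDomain (Ω : Set ℍ) (f : ℍ → ℍ) : Set ℍ :=
  Ω \ zeroSet Ω (symmetrization Ω f)

/-- The regular reciprocal `f^{-*} = (1 / f^s) f^c`, considered on `Ω \ Z_{f^s}`. -/
def regularReciprocal (Ω : Set ℍ) (f : ℍ → ℍ) (q : ℍ) : ℍ :=
  (symmetrization Ω f q)⁻¹ * regularConj Ω f q

/-- The `*`-quotient `f^{-*} * g`, a `*`-product on `Ω \ Z_{f^s}`. -/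
def starQuotient (Ω : Set ℍ) (f g : ℍ → ℍ) : ℍ → ℍ :=
  starProduct (reciprocalDomain Ω f) (regularReciprocal Ω f) g

/-- `T_f(q) = f^c(q)⁻¹ q f^c(q)`, considered on `Ω \ Z_{f^s}`. -/
def twist (Ω : Set ℍ) (f : ℍ → ℍ) (q : ℍ) : ℍ :=
  (regularConj Ω f q)⁻¹ * q * regularConj Ω f q

end SliceRegularity

end

noncomputable section

namespace SliceRegularity

/-! ### Imaginary units and slices -/

/-! A regular function on a symmetric slice domain is induced by a holomorphic stem function: a map
`Φ = a + i b` from a conjugation-symmetric open set of `ℂ` to the complex quaternions `ℍ[ℂ]`, with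
`Φ(conj z)` the complex conjugate of `Φ(z)` and `f(x + I y) = a + I b` for every unit `I`
(`SliceRegular.exists_isInducedBy`). The splitting formulas then turn into pointwise algebra in
`ℍ[ℂ]`: `*` is the product, `f^c` is the quaternionic `star`, `f^s` is the complex scalar `normSq
Φ`, and `f^{-*}` is `(normSq Φ)⁻¹ * star Φ`. This gives well-definedness and independence of `I, J`.

Evaluation at `i = I` is not multiplicative, but its defect is exactly the twist. If `p`, the value
of `P` at `I`, is nonzero, then the value of `P * Q` at `I` is `p` times the value of `Q` at `p⁻¹ I
p` (`evalUnit_mul_of_ne_zero`). With `P = star Φ` this reads `f^s(q) = f^c(q) f(T_f q)`, and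
likewise `(f^{-*} * g)(q) = f^s(q)⁻¹ f^c(q) g(T_f q)`; together they give the quotient formula.
Moreover `f(T_f q) = f^c(q)⁻¹ f^s(q)`, and `f^s(q)` commutes with `q`, so conjugating by `f =
(f^c)^c` at `T_f q` undoes `T_f`.

For smoothness it suffices that induced functions are `C^∞`. Off the real axis, `I` and `x + i y`
depend smoothly on the point. Near a real point, the four coordinates of the stem have power series
with real coefficients, which can be summed directly in `ℍ`. -/

theorem mem_imagUnits_iff_mul_self {I : ℍ} : I ∈ imagUnits ↔ I * I = -1 := by
  simp [imagUnits, sq]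

theorem inner_eq_sum_coords (a b : ℍ) :
    inner ℝ a b = a.re * b.re + a.imI * b.imI + a.imJ * b.imJ + a.imK * b.imK := by
  rw [Quaternion.inner_def]; simp

theorem imagUnits_coords {I : ℍ} (hI : I ∈ imagUnits) :
    I.re = 0 ∧ I.imI ^ 2 + I.imJ ^ 2 + I.imK ^ 2 = 1 := by
  have h := mem_imagUnits_iff_mul_self.1 hI
  have h0 := congrArg QuaternionAlgebra.re h
  have h1 := congrArg QuaternionAlgebra.imI h
  have h2 := congrArg QuaternionAlgebra.imJ h
  have h3 := congrArg QuaternionAlgebra.imK h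
  simp at h0 h1 h2 h3
  have hre : I.re = 0 := by
    by_contra hne
    have e1 : I.imI = 0 := by
      have : I.re * I.imI = 0 := by linarith
      simpa [hne] using this
    have e2 : I.imJ = 0 := by
      have : I.re * I.imJ = 0 := by linarith
      simpa [hne] using this
    have e3 : I.imK = 0 := by
      have : I.re * I.imK = 0 := by linarith
      simpa [hne] using this
    rw [e1, e2, e3] at h0
    nlinarith [sq_nonneg I.re]
  refine ⟨hre, ?_⟩
  rw [hre] at h0
  linarith

theorem mem_imagUnits_of_coords {I : ℍ} (h0 : I.re = 0)
    (h : I.imI ^ 2 + I.imJ ^ 2 + I.imK ^ 2 = 1) : I ∈ imagUnits := by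
  rw [mem_imagUnits_iff_mul_self]
  ext
  · simp [h0]; linarith
  · simp [h0]; ring
  · simp [h0]; ring
  · simp [h0]; ring

theorem star_imagUnits {I : ℍ} (hI : I ∈ imagUnits) : star I = -I := by
  have h := (imagUnits_coords hI).1
  ext <;> simp [h]

theorem neg_mem_imagUnits {I : ℍ} (hI : I ∈ imagUnits) : -I ∈ imagUnits := by
  rw [mem_imagUnits_iff_mul_self] at *
  simpa using hI

theorem conj_mem_imagUnits {I p : ℍ} (hI : I ∈ imagUnits) (hp : p ≠ 0) :
    p⁻¹ * I * p ∈ imagUnits := by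
  rw [mem_imagUnits_iff_mul_self] at *
  calc p⁻¹ * I * p * (p⁻¹ * I * p) = p⁻¹ * I * (p * p⁻¹) * I * p := by noncomm_ring
    _ = p⁻¹ * (I * I) * p := by rw [mul_inv_cancel₀ hp]; noncomm_ring
    _ = -1 := by rw [hI]; simp [inv_mul_cancel₀ hp]

/-- The standard imaginary unit `i`. -/
def unitI : ℍ := ⟨0, 1, 0, 0⟩

/-- The standard imaginary unit `j`. -/
def unitJ : ℍ := ⟨0, 0, 1, 0⟩

theorem unitI_mem : unitI ∈ imagUnits := mem_imagUnits_of_coords rfl (by simp [unitI])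

theorem unitJ_mem : unitJ ∈ imagUnits := mem_imagUnits_of_coords rfl (by simp [unitJ])

theorem inner_unitI_unitJ : inner ℝ unitI unitJ = 0 := by
  rw [inner_eq_sum_coords]; simp [unitI, unitJ]

theorem exists_orthogonal_imagUnit {I : ℍ} (hI : I ∈ imagUnits) :
    ∃ J ∈ imagUnits, inner ℝ I J = 0 := by
  obtain ⟨h0, h1⟩ := imagUnits_coords hI
  by_cases h : I.imJ ^ 2 + I.imK ^ 2 = 0
  · have e : I.imJ = 0 := by nlinarith [sq_nonneg I.imJ, sq_nonneg I.imK]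
    exact ⟨unitJ, unitJ_mem, by rw [inner_eq_sum_coords]; simp [unitJ, e, h0]⟩
  · set s := Real.sqrt (I.imJ ^ 2 + I.imK ^ 2) with hs
    have hs2 : s ^ 2 = I.imJ ^ 2 + I.imK ^ 2 := Real.sq_sqrt (by positivity)
    have hsne : s ≠ 0 := fun hz => h (by rw [← hs2, hz]; norm_num)
    -- The witness is the `j, k` component of `I`, turned by a right angle in that plane and
    -- normalized.
    obtain ⟨J, j0, j1, j2, j3⟩ : ∃ J : ℍ, J.re = 0 ∧ J.imI = 0 ∧ J.imJ = I.imK / s ∧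
      J.imK = -I.imJ / s := ⟨⟨0, 0, I.imK / s, -I.imJ / s⟩, rfl, rfl, rfl, rfl⟩
    refine ⟨J, mem_imagUnits_of_coords j0 ?_, ?_⟩
    · rw [j1, j2, j3]
      field_simp
      linarith
    · rw [inner_eq_sum_coords, j0, j1, j2, j3]
      ring

theorem orthogonal_coords {I J : ℍ} (hI : I ∈ imagUnits) (h : inner ℝ I J = 0) :
    I.imI * J.imI + I.imJ * J.imJ + I.imK * J.imK = 0 := by
  have := (imagUnits_coords hI).1
  simpa [Quaternion.inner_def, this] using h

theorem orthogonal_anticomm {I J : ℍ} (hI : I ∈ imagUnits) (hJ : J ∈ imagUnits)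
    (h : inner ℝ I J = 0) : J * I = -(I * J) := by
  have h0 := (imagUnits_coords hI).1
  have h1 := (imagUnits_coords hJ).1
  have h2 := orthogonal_coords hI h
  ext
  · simp [h0, h1]; linarith
  · simp [h0, h1]; ring
  · simp [h0, h1]; ring
  · simp [h0, h1]; ring

theorem coe_mul_comm (r : ℝ) (q : ℍ) : q * (r : ℍ) = (r : ℍ) * q :=
  (Quaternion.coe_commutes r q).symm

/-! ### The embeddings `ℂ → ℝ + I ℝ` -/

@[simp] theorem sliceMap_re {I : ℍ} (hI : I ∈ imagUnits) (z : ℂ) : (sliceMap I z).re = z.re := by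
  simp [sliceMap, (imagUnits_coords hI).1]

/-- `sliceMap I` as a continuous real linear map. -/
def sliceCLM (I : ℍ) : ℂ →L[ℝ] ℍ :=
  LinearMap.toContinuousLinearMap
    { toFun := sliceMap I
      map_add' := fun z w => by simp [sliceMap, mul_add]; abel
      map_smul' := fun r z => by
        ext <;> simp [sliceMap] <;> ring }

@[simp] theorem sliceCLM_apply (I : ℍ) (z : ℂ) : sliceCLM I z = sliceMap I z := rfl

theorem sliceMap_add (I : ℍ) (z w : ℂ) : sliceMap I (z + w) = sliceMap I z + sliceMap I w :=
  (sliceCLM I).map_add z w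

theorem sliceMap_sub (I : ℍ) (z w : ℂ) : sliceMap I (z - w) = sliceMap I z - sliceMap I w :=
  (sliceCLM I).map_sub z w

theorem sliceMap_mul {I : ℍ} (hI : I ∈ imagUnits) (z w : ℂ) :
    sliceMap I (z * w) = sliceMap I z * sliceMap I w := by
  have h := mem_imagUnits_iff_mul_self.1 hI
  have e : sliceMap I z * sliceMap I w
      = (z.re : ℍ) * w.re + I * (z.im * w.re) + (z.re : ℍ) * I * w.im
        + I * z.im * I * w.im := by simp only [sliceMap]; noncomm_ring
  have e2 : I * (z.im : ℍ) * I * w.im = -((z.im : ℍ) * w.im) := by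
    rw [coe_mul_comm z.im I, mul_assoc (z.im : ℍ) I I, h]; noncomm_ring
  rw [e, e2, ← coe_mul_comm z.re I]
  simp only [sliceMap, Complex.mul_re, Complex.mul_im, Quaternion.coe_sub, Quaternion.coe_mul,
    Quaternion.coe_add]
  noncomm_ring

@[simp] theorem sliceMap_ofReal (I : ℍ) (r : ℝ) : sliceMap I (r : ℂ) = (r : ℍ) := by
  simp [sliceMap]

@[simp] theorem sliceMap_zero (I : ℍ) : sliceMap I 0 = 0 := by
  simp [sliceMap]

@[simp] theorem sliceMap_one (I : ℍ) : sliceMap I 1 = 1 := by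
  simp [sliceMap]

@[simp] theorem sliceMap_I (I : ℍ) : sliceMap I Complex.I = I := by
  simp [sliceMap]

theorem sliceMap_neg_unit (I : ℍ) (z : ℂ) : sliceMap (-I) z = sliceMap I (star z) := by
  simp [sliceMap]

theorem star_sliceMap {I : ℍ} (hI : I ∈ imagUnits) (z : ℂ) :
    star (sliceMap I z) = sliceMap I (star z) := by
  simp [sliceMap, star_imagUnits hI, coe_mul_comm]

theorem normSq_sliceMap {I : ℍ} (hI : I ∈ imagUnits) (z : ℂ) :
    Quaternion.normSq (sliceMap I z) = Complex.normSq z := by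
  obtain ⟨h0, h1⟩ := imagUnits_coords hI
  rw [Quaternion.normSq_def', Complex.normSq_apply]
  simp [sliceMap, h0]
  linear_combination z.im ^ 2 * h1

theorem norm_sliceMap {I : ℍ} (hI : I ∈ imagUnits) (z : ℂ) : ‖sliceMap I z‖ = ‖z‖ := by
  have h := normSq_sliceMap hI z
  rw [Quaternion.normSq_eq_norm_mul_self, Complex.normSq_eq_norm_sq, ← sq] at h
  exact (sq_eq_sq₀ (norm_nonneg _) (norm_nonneg _)).1 h

theorem sliceMap_eq_zero {I : ℍ} (hI : I ∈ imagUnits) {z : ℂ} : sliceMap I z = 0 ↔ z = 0 := by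
  rw [← norm_eq_zero, norm_sliceMap hI, norm_eq_zero]

theorem sliceMap_inv {I : ℍ} (hI : I ∈ imagUnits) (z : ℂ) :
    sliceMap I z⁻¹ = (sliceMap I z)⁻¹ := by
  by_cases h : z = 0
  · simp [h]
  · refine eq_inv_of_mul_eq_one_left ?_
    rw [← sliceMap_mul hI, inv_mul_cancel₀ h, sliceMap_one]

theorem sliceMap_pow {I : ℍ} (hI : I ∈ imagUnits) (z : ℂ) (n : ℕ) :
    sliceMap I (z ^ n) = sliceMap I z ^ n := by
  induction n with
  | zero => simp
  | succ n ih => rw [pow_succ, sliceMap_mul hI, ih, pow_succ]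

/-- Inner automorphisms fix the reals, so they move only the imaginary unit. Hence the twist
preserves each sphere `x + y 𝕊`. -/
theorem conj_sliceMap {I p : ℍ} (hp : p ≠ 0) (z : ℂ) :
    p⁻¹ * sliceMap I z * p = sliceMap (p⁻¹ * I * p) z := by
  simp only [sliceMap, mul_add, add_mul]
  rw [coe_mul_comm, mul_assoc, inv_mul_cancel₀ hp, mul_one]
  congr 1
  rw [mul_assoc (p⁻¹ * I), coe_mul_comm z.im p]
  noncomm_ring

theorem sliceMap_mul_orthogonal {I J : ℍ} (hI : I ∈ imagUnits) (hJ : J ∈ imagUnits)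
    (h : inner ℝ I J = 0) (z : ℂ) : J * sliceMap I z = sliceMap I (star z) * J := by
  simp only [sliceMap, mul_add, add_mul, ← mul_assoc, orthogonal_anticomm hI hJ h]
  rw [coe_mul_comm z.re J, mul_assoc I _ J]
  simp [← coe_mul_comm z.im J, mul_assoc]

/-! ### Complex coordinates -/

/-- The complex coordinate `⟨v, q⟩ + i ⟨I v, q⟩` of `q`; it is complex linear in `q` for the complex
structure given by left multiplication by `I`. -/
def sliceCoord (I v : ℍ) : ℍ →L[ℝ] ℂ :=
  Complex.ofRealCLM.comp (innerSL ℝ v) +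
    Complex.I • Complex.ofRealCLM.comp (innerSL ℝ (I * v))

theorem sliceCoord_apply (I v q : ℍ) :
    sliceCoord I v q = ((inner ℝ v q : ℝ) : ℂ) + Complex.I * ((inner ℝ (I * v) q : ℝ) : ℂ) := by
  simp [sliceCoord]

theorem inner_unit_mul {I : ℍ} (hI : I ∈ imagUnits) (v q : ℍ) :
    inner ℝ v (I * q) = - inner ℝ (I * v) q := by
  have h0 := (imagUnits_coords hI).1
  simp [Quaternion.inner_def, h0]
  ring

theorem sliceCoord_unit_mul {I : ℍ} (hI : I ∈ imagUnits) (v q : ℍ) :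
    sliceCoord I v (I * q) = Complex.I * sliceCoord I v q := by
  have h1 : inner ℝ (I * v) (I * q) = inner ℝ v q := by
    rw [inner_unit_mul hI, ← mul_assoc, mem_imagUnits_iff_mul_self.1 hI]
    simp
  rw [sliceCoord_apply, sliceCoord_apply, inner_unit_mul hI v q, h1]
  apply Complex.ext <;> simp

theorem sliceCoord_sliceMap_mul {I : ℍ} (hI : I ∈ imagUnits) (v q : ℍ) (z : ℂ) :
    sliceCoord I v (sliceMap I z * q) = z * sliceCoord I v q := by
  have e : sliceMap I z * q = z.re • q + z.im • (I * q) := by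
    rw [← Quaternion.coe_mul_eq_smul, ← Quaternion.coe_mul_eq_smul, sliceMap, add_mul,
      coe_mul_comm, mul_assoc]
  rw [e, map_add, map_smul, map_smul, sliceCoord_unit_mul hI]
  conv_rhs => rw [← Complex.re_add_im z]
  simp only [Complex.real_smul]
  ring

/-- Conjugation by `I`, which is `q ↦ -I q I`, is the identity on `ℝ + I ℝ` and `-1` on its
orthogonal complement; averaging it with the identity gives the orthogonal projection. -/
theorem sliceMap_sliceCoord_one {I : ℍ} (hI : I ∈ imagUnits) (q : ℍ) :
    sliceMap I (sliceCoord I 1 q) = (1 / 2 : ℝ) • (q - I * q * I) := by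
  obtain ⟨h0, h1⟩ := imagUnits_coords hI
  rw [sliceCoord_apply, Quaternion.inner_def, Quaternion.inner_def]
  ext
  · simp [sliceMap, h0]; linear_combination - (1 / 2) * q.re * h1
  · simp [sliceMap, h0]; linear_combination (1 / 2) * q.imI * h1
  · simp [sliceMap, h0]; linear_combination (1 / 2) * q.imJ * h1
  · simp [sliceMap, h0]; linear_combination (1 / 2) * q.imK * h1

/-- The adjoint of right multiplication by `J` is right multiplication by `-J`. This reduces the
second coordinate of a splitting to the first. -/
theorem sliceCoord_orthogonal {I J : ℍ} (hJ : J ∈ imagUnits) (q : ℍ) :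
    sliceCoord I J q = sliceCoord I 1 (-(q * J)) := by
  have h : ∀ v : ℍ, inner ℝ (v * J) q = inner ℝ v (-(q * J)) := by
    intro v
    rw [Quaternion.inner_def, Quaternion.inner_def, star_neg, star_mul, star_imagUnits hJ]
    noncomm_ring
  have h1 := h 1
  have h2 := h I
  rw [one_mul] at h1
  rw [sliceCoord_apply, sliceCoord_apply, h1, h2, mul_one]

theorem sliceMap_sliceCoord {I J : ℍ} (hI : I ∈ imagUnits) (hJ : J ∈ imagUnits)
    (h : inner ℝ I J = 0) (q : ℍ) :
    q = sliceMap I (sliceCoord I 1 q) + sliceMap I (sliceCoord I J q) * J := by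
  have hII := mem_imagUnits_iff_mul_self.1 hI
  have hJJ := mem_imagUnits_iff_mul_self.1 hJ
  have hJI := orthogonal_anticomm hI hJ h
  have e1 : I * (q * J) * I * J = I * q * I := by
    calc I * (q * J) * I * J = I * q * (J * I) * J := by noncomm_ring
      _ = -(I * q * I * (J * J)) := by rw [hJI]; noncomm_ring
      _ = I * q * I := by rw [hJJ]; noncomm_ring
  have e2 : q * J * J = -q := by rw [mul_assoc, hJJ]; noncomm_ring
  rw [sliceCoord_orthogonal hJ, sliceMap_sliceCoord_one hI, sliceMap_sliceCoord_one hI,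
    smul_mul_assoc, ← smul_add]
  have e3 : q - I * q * I + (-(q * J) - I * -(q * J) * I) * J = (2 : ℝ) • q := by
    have : (-(q * J) - I * -(q * J) * I) * J = -(q * J * J) + I * (q * J) * I * J := by
      noncomm_ring
    rw [this, e1, e2, two_smul]; abel
  rw [e3, smul_smul]; norm_num

theorem eq_of_sliceCoord_eq {I J : ℍ} (hI : I ∈ imagUnits) (hJ : J ∈ imagUnits)
    (h : inner ℝ I J = 0) {p q : ℍ} (h1 : sliceCoord I 1 p = sliceCoord I 1 q)
    (h2 : sliceCoord I J p = sliceCoord I J q) : p = q := by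
  rw [sliceMap_sliceCoord hI hJ h p, h1, h2, ← sliceMap_sliceCoord hI hJ h q]

theorem sliceCoord_splitting {I J : ℍ} (hI : I ∈ imagUnits) (hJ : J ∈ imagUnits)
    (h : inner ℝ I J = 0) (z w : ℂ) :
    sliceCoord I 1 (sliceMap I z + sliceMap I w * J) = z ∧
      sliceCoord I J (sliceMap I z + sliceMap I w * J) = w := by
  obtain ⟨a0, a1⟩ := imagUnits_coords hI
  obtain ⟨b0, b1⟩ := imagUnits_coords hJ
  have c := orthogonal_coords hI h
  have e1 : sliceCoord I 1 (1 : ℍ) = 1 := by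
    simp [sliceCoord_apply, Quaternion.inner_def, a0]
  have e2 : sliceCoord I 1 J = 0 := by
    rw [sliceCoord_apply]; simp [h]; simp [Quaternion.inner_def, b0]
  have e3 : sliceCoord I J (1 : ℍ) = 0 := by
    simp [sliceCoord_apply, Quaternion.inner_def, b0, a0]
    exact_mod_cast (by linarith : -(I.imI * J.imI) - I.imJ * J.imJ - I.imK * J.imK = 0)
  have e4 : sliceCoord I J J = 1 := by
    have h1 : inner ℝ J J = 1 := by
      rw [Quaternion.inner_def]; simp [b0]; linarith
    have h2 : inner ℝ (I * J) J = 0 := by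
      simp [Quaternion.inner_def, a0, b0]; ring
    rw [sliceCoord_apply, h1, h2]; simp
  constructor
  · rw [map_add, ← mul_one (sliceMap I z), sliceCoord_sliceMap_mul hI,
      sliceCoord_sliceMap_mul hI, e1, e2]; simp
  · rw [map_add, ← mul_one (sliceMap I z), sliceCoord_sliceMap_mul hI,
      sliceCoord_sliceMap_mul hI, e3, e4]; simp

/-! ### Holomorphic maps from the complex plane to a slice complex structure -/

/-- `u : D → ℍ` is holomorphic for the complex structure of left multiplication by `I`. -/
structure HolomorphicFor (I : ℍ) (D : Set ℂ) (u : ℂ → ℍ) : Prop where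
  contDiffOn : ContDiffOn ℝ 1 u D
  fderiv_I : ∀ z ∈ D, fderiv ℝ u z Complex.I = I * fderiv ℝ u z 1

theorem holomorphicOnSlice_iff {Ω : Set ℍ} {I : ℍ} (hI : I ∈ imagUnits) {f : ℍ → ℍ} :
    HolomorphicOnSlice Ω I f ↔
      HolomorphicFor I (sliceMap I ⁻¹' Ω) (fun z => f (sliceMap I z)) := by
  have hII := mem_imagUnits_iff_mul_self.1 hI
  have key : ∀ a b : ℍ, (1 / 2 : ℝ) • (a + I * b) = 0 ↔ b = I * a := by
    intro a b
    rw [smul_eq_zero]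
    constructor
    · rintro (h | h)
      · norm_num at h
      · rw [eq_neg_of_add_eq_zero_left h, mul_neg, ← mul_assoc, hII]; simp
    · rintro rfl
      right
      rw [← mul_assoc, hII]; simp
  constructor
  · rintro ⟨h1, h2⟩
    exact ⟨h1, fun z hz => (key _ _).1 (h2 z hz)⟩
  · rintro ⟨h1, h2⟩
    exact ⟨h1, fun z hz => (key _ _).2 (h2 z hz)⟩

namespace HolomorphicFor

variable {I : ℍ} {D : Set ℂ} {u v : ℂ → ℍ}

theorem differentiableAt (h : HolomorphicFor I D u) (hD : IsOpen D) {z : ℂ} (hz : z ∈ D) :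
    DifferentiableAt ℝ u z :=
  (h.contDiffOn.contDiffAt (hD.mem_nhds hz)).differentiableAt (by norm_num)

theorem congr (h : HolomorphicFor I D u) (hD : IsOpen D) (huv : ∀ z ∈ D, v z = u z) :
    HolomorphicFor I D v where
  contDiffOn := h.contDiffOn.congr huv
  fderiv_I z hz := by
    have : v =ᶠ[nhds z] u := Filter.eventuallyEq_of_mem (hD.mem_nhds hz) huv
    rw [this.fderiv_eq]
    exact h.fderiv_I z hz

theorem add (hu : HolomorphicFor I D u) (hv : HolomorphicFor I D v) (hD : IsOpen D) :
    HolomorphicFor I D (fun z => u z + v z) where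
  contDiffOn := hu.contDiffOn.add hv.contDiffOn
  fderiv_I z hz := by
    rw [fderiv_fun_add (hu.differentiableAt hD hz) (hv.differentiableAt hD hz)]
    simp only [_root_.add_apply, hu.fderiv_I z hz, hv.fderiv_I z hz, mul_add]

theorem sliceMap_mul_const (hI : I ∈ imagUnits) (hD : IsOpen D) {φ : ℂ → ℂ}
    (hφ : DifferentiableOn ℂ φ D) (c : ℍ) :
    HolomorphicFor I D (fun z => sliceMap I (φ z) * c) := by
  set L : ℂ →L[ℝ] ℍ := ((ContinuousLinearMap.mul ℝ ℍ).flip c).comp (sliceCLM I) with hL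
  have hLa : ∀ z, L z = sliceMap I z * c := fun z => by simp [hL]
  have hφ' : ContDiffOn ℝ 1 φ D := (hφ.contDiffOn hD).restrict_scalars ℝ
  refine ⟨?_, fun z hz => ?_⟩
  · have := L.contDiff.comp_contDiffOn (n := 1) hφ'
    exact this.congr fun z _ => (hLa _).symm
  · have h1 := differentiableAt_complex_iff_differentiableAt_real.1
      (hφ.differentiableAt (hD.mem_nhds hz))
    have h2 : HasFDerivAt (fun z => sliceMap I (φ z) * c) (L.comp (fderiv ℝ φ z)) z := by
      have := L.hasFDerivAt.comp z h1.1.hasFDerivAt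
      exact this.congr_of_eventuallyEq (Filter.Eventually.of_forall fun w => (hLa _).symm)
    rw [h2.fderiv]
    simp only [ContinuousLinearMap.comp_apply, hLa, h1.2, smul_eq_mul, sliceMap_mul hI,
      sliceMap_I, mul_assoc]

theorem sliceMap_comp (hI : I ∈ imagUnits) (hD : IsOpen D) {φ : ℂ → ℂ}
    (hφ : DifferentiableOn ℂ φ D) : HolomorphicFor I D (fun z => sliceMap I (φ z)) := by
  simpa using sliceMap_mul_const hI hD hφ 1

/-- Since `sliceCoord` intertwines left multiplication by `I` with multiplication by `i`, it
converts slice holomorphy into ordinary complex differentiability. -/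
theorem differentiableOn_sliceCoord (h : HolomorphicFor I D u) (hI : I ∈ imagUnits) (hD : IsOpen D) (w : ℍ) :
    DifferentiableOn ℂ (fun z => sliceCoord I w (u z)) D := by
  intro z hz
  refine DifferentiableAt.differentiableWithinAt ?_
  rw [differentiableAt_complex_iff_differentiableAt_real]
  have h1 : HasFDerivAt (fun z => sliceCoord I w (u z))
      ((sliceCoord I w).comp (fderiv ℝ u z)) z :=
    (sliceCoord I w).hasFDerivAt.comp z (h.differentiableAt hD hz).hasFDerivAt
  refine ⟨h1.differentiableAt, ?_⟩
  rw [h1.fderiv]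
  simp only [ContinuousLinearMap.comp_apply, h.fderiv_I z hz, sliceCoord_unit_mul hI, smul_eq_mul]

end HolomorphicFor

/-! ### Stem functions -/

/-- The real part of a complex quaternion `a + i b`, with `a` and `b` quaternions. -/
def rePart (Q : ℍ[ℂ]) : ℍ := ⟨Q.re.re, Q.imI.re, Q.imJ.re, Q.imK.re⟩

/-- The imaginary part of a complex quaternion `a + i b`, with `a` and `b` quaternions. -/
def imPart (Q : ℍ[ℂ]) : ℍ := ⟨Q.re.im, Q.imI.im, Q.imJ.im, Q.imK.im⟩

/-- Complex conjugation `a + i b ↦ a - i b` of complex quaternions. -/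
def complexConj (Q : ℍ[ℂ]) : ℍ[ℂ] := ⟨star Q.re, star Q.imI, star Q.imJ, star Q.imK⟩

section parts

variable (Q : ℍ[ℂ])

@[simp] theorem rePart_re : (rePart Q).re = Q.re.re := rfl
@[simp] theorem rePart_imI : (rePart Q).imI = Q.imI.re := rfl
@[simp] theorem rePart_imJ : (rePart Q).imJ = Q.imJ.re := rfl
@[simp] theorem rePart_imK : (rePart Q).imK = Q.imK.re := rfl
@[simp] theorem imPart_re : (imPart Q).re = Q.re.im := rfl
@[simp] theorem imPart_imI : (imPart Q).imI = Q.imI.im := rfl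
@[simp] theorem imPart_imJ : (imPart Q).imJ = Q.imJ.im := rfl
@[simp] theorem imPart_imK : (imPart Q).imK = Q.imK.im := rfl
@[simp] theorem complexConj_re : (complexConj Q).re = star Q.re := rfl
@[simp] theorem complexConj_imI : (complexConj Q).imI = star Q.imI := rfl
@[simp] theorem complexConj_imJ : (complexConj Q).imJ = star Q.imJ := rfl
@[simp] theorem complexConj_imK : (complexConj Q).imK = star Q.imK := rfl

end parts

/-! ### Evaluation of complex quaternions at an imaginary unit -/

/-- The value `a + I b` of the complex quaternion `a + i b` at `i = I`. -/
def evalUnit (I : ℍ) (Q : ℍ[ℂ]) : ℍ := rePart Q + I * imPart Q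

theorem rePart_mul (P Q : ℍ[ℂ]) :
    rePart (P * Q) = rePart P * rePart Q - imPart P * imPart Q := by
  ext <;> simp <;> ring

theorem imPart_mul (P Q : ℍ[ℂ]) :
    imPart (P * Q) = rePart P * imPart Q + imPart P * rePart Q := by
  ext <;> simp <;> ring

theorem rePart_star (Q : ℍ[ℂ]) : rePart (star Q) = star (rePart Q) := by
  ext <;> simp

theorem imPart_star (Q : ℍ[ℂ]) : imPart (star Q) = star (imPart Q) := by
  ext <;> simp

theorem rePart_complexConj (Q : ℍ[ℂ]) : rePart (complexConj Q) = rePart Q := by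
  ext <;> simp

theorem imPart_complexConj (Q : ℍ[ℂ]) : imPart (complexConj Q) = -imPart Q := by
  ext <;> simp

theorem complexConj_mul (P Q : ℍ[ℂ]) : complexConj (P * Q) = complexConj P * complexConj Q := by
  ext1 <;> simp

theorem complexConj_star (P : ℍ[ℂ]) : complexConj (star P) = star (complexConj P) := by
  ext1 <;> simp

theorem evalUnit_complexConj (I : ℍ) (Q : ℍ[ℂ]) :
    evalUnit I (complexConj Q) = evalUnit (-I) Q := by
  simp [evalUnit, rePart_complexConj, imPart_complexConj]

theorem evalUnit_mul {I : ℍ} (hI : I ∈ imagUnits) (P Q : ℍ[ℂ]) :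
    evalUnit I (P * Q) = evalUnit I P * rePart Q + I * evalUnit I P * imPart Q := by
  have h : I * (rePart P + I * imPart P) * imPart Q
      = I * rePart P * imPart Q + (I * I) * imPart P * imPart Q := by noncomm_ring
  simp only [evalUnit, rePart_mul, imPart_mul, h, mem_imagUnits_iff_mul_self.1 hI]
  noncomm_ring

theorem evalUnit_mul_of_eq_zero {I : ℍ} (hI : I ∈ imagUnits) {P : ℍ[ℂ]} (Q : ℍ[ℂ])
    (h : evalUnit I P = 0) : evalUnit I (P * Q) = 0 := by
  rw [evalUnit_mul hI, h]; simp

/-- Source of the twist: with `Q = c + i d`, the product evaluates to `p c + I p d`, and `I p = p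
(p⁻¹ I p)` lets `p` be factored out on the left. -/
theorem evalUnit_mul_of_ne_zero {I : ℍ} (hI : I ∈ imagUnits) {P : ℍ[ℂ]} (Q : ℍ[ℂ])
    (h : evalUnit I P ≠ 0) :
    evalUnit I (P * Q) =
      evalUnit I P * evalUnit ((evalUnit I P)⁻¹ * I * evalUnit I P) Q := by
  rw [evalUnit_mul hI]
  generalize evalUnit I P = p at *
  rw [evalUnit, mul_add, ← mul_assoc, ← mul_assoc, ← mul_assoc, mul_inv_cancel₀ h, one_mul]

/-- A complex scalar takes its value in `ℝ + I ℝ`, which commutes with `I`, so no twist appears. -/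
theorem evalUnit_coe_mul {I : ℍ} (hI : I ∈ imagUnits) (c : ℂ) (Q : ℍ[ℂ]) :
    evalUnit I ((c : ℍ[ℂ]) * Q) = sliceMap I c * evalUnit I Q := by
  have h1 : rePart (c : ℍ[ℂ]) = (c.re : ℍ) := by ext <;> simp
  have h2 : imPart (c : ℍ[ℂ]) = (c.im : ℍ) := by ext <;> simp
  have h3 : I * sliceMap I c = sliceMap I c * I := by
    rw [sliceMap, mul_add, add_mul, coe_mul_comm c.re I, mul_assoc, coe_mul_comm c.im I]
  rw [evalUnit_mul hI]
  have h4 : evalUnit I (c : ℍ[ℂ]) = sliceMap I c := by rw [evalUnit, h1, h2, sliceMap]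
  rw [h4, h3, evalUnit]
  noncomm_ring

theorem evalUnit_coe {I : ℍ} (hI : I ∈ imagUnits) (c : ℂ) :
    evalUnit I (c : ℍ[ℂ]) = sliceMap I c := by
  have h1 : rePart (1 : ℍ[ℂ]) = 1 := by ext <;> simp
  have h2 : imPart (1 : ℍ[ℂ]) = 0 := by ext <;> simp
  have h := evalUnit_coe_mul hI c 1
  have h3 : evalUnit I 1 = 1 := by rw [evalUnit, h1, h2, mul_zero, add_zero]
  rwa [mul_one, h3, mul_one] at h

/-- The standard imaginary unit `k`. -/
def unitK : ℍ := ⟨0, 0, 0, 1⟩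

@[simp] theorem unitI_re : unitI.re = 0 := rfl
@[simp] theorem unitI_imI : unitI.imI = 1 := rfl
@[simp] theorem unitI_imJ : unitI.imJ = 0 := rfl
@[simp] theorem unitI_imK : unitI.imK = 0 := rfl
@[simp] theorem unitJ_re : unitJ.re = 0 := rfl
@[simp] theorem unitJ_imI : unitJ.imI = 0 := rfl
@[simp] theorem unitJ_imJ : unitJ.imJ = 1 := rfl
@[simp] theorem unitJ_imK : unitJ.imK = 0 := rfl
@[simp] theorem unitK_re : unitK.re = 0 := rfl
@[simp] theorem unitK_imI : unitK.imI = 0 := rfl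
@[simp] theorem unitK_imJ : unitK.imJ = 0 := rfl
@[simp] theorem unitK_imK : unitK.imK = 1 := rfl

/-- Holomorphy and smoothness of an induced function are read off from these four terms, each a
complex function moved to `ℝ + I ℝ` times a constant. -/
theorem evalUnit_eq_sum (I : ℍ) (Q : ℍ[ℂ]) :
    evalUnit I Q = sliceMap I Q.re * 1 + sliceMap I Q.imI * unitI + sliceMap I Q.imJ * unitJ
      + sliceMap I Q.imK * unitK := by
  ext <;> simp [evalUnit, sliceMap] <;> ring

/-! ### Profiles of symmetric sets and stem functions on them -/

/-- The set of `x + i y` such that `x + y 𝕊` lies in the axially symmetric set `T`. -/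
def profile (T : Set ℍ) : Set ℂ := sliceMap unitI ⁻¹' T

theorem AxiallySymmetric.mem_profile {T : Set ℍ} (hT : AxiallySymmetric T) {I : ℍ}
    (hI : I ∈ imagUnits) {z : ℂ} : z ∈ profile T ↔ sliceMap I z ∈ T :=
  ⟨fun h => hT z.re z.im unitI unitI_mem h I hI, fun h => hT z.re z.im I hI h unitI unitI_mem⟩

theorem AxiallySymmetric.preimage {T : Set ℍ} (hT : AxiallySymmetric T) {I : ℍ}
    (hI : I ∈ imagUnits) : sliceMap I ⁻¹' T = profile T :=
  Set.ext fun _ => (hT.mem_profile hI).symm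

theorem isOpen_profile {T : Set ℍ} (hT : IsOpen T) : IsOpen (profile T) :=
  hT.preimage (sliceCLM unitI).continuous

theorem AxiallySymmetric.star_mem_profile {T : Set ℍ} (hT : AxiallySymmetric T) {z : ℂ}
    (hz : z ∈ profile T) : star z ∈ profile T := by
  rw [hT.mem_profile unitI_mem, ← sliceMap_neg_unit,
    ← hT.mem_profile (neg_mem_imagUnits unitI_mem)]
  exact hz

/-- Holomorphic stem functions on `D`. -/
structure IsStem (D : Set ℂ) (Φ : ℂ → ℍ[ℂ]) : Prop where
  re : DifferentiableOn ℂ (fun z => (Φ z).re) D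
  imI : DifferentiableOn ℂ (fun z => (Φ z).imI) D
  imJ : DifferentiableOn ℂ (fun z => (Φ z).imJ) D
  imK : DifferentiableOn ℂ (fun z => (Φ z).imK) D
  conj : ∀ z ∈ D, Φ (star z) = complexConj (Φ z)

namespace IsStem

variable {D : Set ℂ} {Φ Ψ : ℂ → ℍ[ℂ]}

theorem mono {D' : Set ℂ} (h : IsStem D Φ) (hD : D' ⊆ D) : IsStem D' Φ :=
  ⟨h.re.mono hD, h.imI.mono hD, h.imJ.mono hD, h.imK.mono hD, fun z hz => h.conj z (hD hz)⟩

theorem mul (hΦ : IsStem D Φ) (hΨ : IsStem D Ψ) : IsStem D (fun z => Φ z * Ψ z) where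
  re := by
    simp only [Quaternion.re_mul]
    exact (((hΦ.re.mul hΨ.re).sub (hΦ.imI.mul hΨ.imI)).sub (hΦ.imJ.mul hΨ.imJ)).sub
      (hΦ.imK.mul hΨ.imK)
  imI := by
    simp only [Quaternion.imI_mul]
    exact (((hΦ.re.mul hΨ.imI).add (hΦ.imI.mul hΨ.re)).add (hΦ.imJ.mul hΨ.imK)).sub
      (hΦ.imK.mul hΨ.imJ)
  imJ := by
    simp only [Quaternion.imJ_mul]
    exact (((hΦ.re.mul hΨ.imJ).sub (hΦ.imI.mul hΨ.imK)).add (hΦ.imJ.mul hΨ.re)).add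
      (hΦ.imK.mul hΨ.imI)
  imK := by
    simp only [Quaternion.imK_mul]
    exact (((hΦ.re.mul hΨ.imK).add (hΦ.imI.mul hΨ.imJ)).sub (hΦ.imJ.mul hΨ.imI)).add
      (hΦ.imK.mul hΨ.re)
  conj z hz := by simp only [hΦ.conj z hz, hΨ.conj z hz, complexConj_mul]

theorem conjugate (hΦ : IsStem D Φ) : IsStem D (fun z => star (Φ z)) where
  re := by simpa using hΦ.re
  imI := by simpa using hΦ.imI.neg
  imJ := by simpa using hΦ.imJ.neg
  imK := by simpa using hΦ.imK.neg
  conj z hz := by simp only [hΦ.conj z hz, complexConj_star]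

theorem normSq (hΦ : IsStem D Φ) : DifferentiableOn ℂ (fun z => Quaternion.normSq (Φ z)) D := by
  have h := (hΦ.mul hΦ.conjugate).re
  simpa [Quaternion.self_mul_star] using h

theorem normSq_conj (hΦ : IsStem D Φ) {z : ℂ} (hz : z ∈ D) :
    Quaternion.normSq (Φ (star z)) = star (Quaternion.normSq (Φ z)) := by
  rw [hΦ.conj z hz, Quaternion.normSq_def', Quaternion.normSq_def']
  simp

theorem coe {c : ℂ → ℂ} (hc : DifferentiableOn ℂ c D)
    (h : ∀ z ∈ D, c (star z) = star (c z)) : IsStem D (fun z => (c z : ℍ[ℂ])) where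
  re := by simpa using hc
  imI := by simp
  imJ := by simp
  imK := by simp
  conj z hz := by
    rw [h z hz]
    ext1 <;> simp

theorem holomorphicFor (hΦ : IsStem D Φ) (hD : IsOpen D) {I : ℍ} (hI : I ∈ imagUnits) :
    HolomorphicFor I D (fun z => evalUnit I (Φ z)) := by
  simp only [evalUnit_eq_sum]
  exact (((HolomorphicFor.sliceMap_mul_const hI hD hΦ.re _).add
    (HolomorphicFor.sliceMap_mul_const hI hD hΦ.imI _) hD).add
    (HolomorphicFor.sliceMap_mul_const hI hD hΦ.imJ _) hD).add
    (HolomorphicFor.sliceMap_mul_const hI hD hΦ.imK _) hD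

end IsStem

/-! ### Slice functions induced by stem functions -/

/-- `f` is the slice function on `T` induced by the holomorphic stem function `Φ`. -/
structure IsInducedBy (T : Set ℍ) (f : ℍ → ℍ) (Φ : ℂ → ℍ[ℂ]) : Prop where
  isStem : IsStem (profile T) Φ
  eq : ∀ I ∈ imagUnits, ∀ z ∈ profile T, f (sliceMap I z) = evalUnit I (Φ z)

theorem IsInducedBy.sliceRegular {T : Set ℍ} {f : ℍ → ℍ} {Φ : ℂ → ℍ[ℂ]} (h : IsInducedBy T f Φ)
    (hT : IsOpen T) (hs : AxiallySymmetric T) : SliceRegular T f := by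
  intro I hI
  rw [holomorphicOnSlice_iff hI, hs.preimage hI]
  exact (h.isStem.holomorphicFor (isOpen_profile hT) hI).congr (isOpen_profile hT) (h.eq I hI)

theorem IsInducedBy.mono {T T' : Set ℍ} {f : ℍ → ℍ} {Φ : ℂ → ℍ[ℂ]} (h : IsInducedBy T f Φ)
    (hT : T' ⊆ T) : IsInducedBy T' f Φ :=
  ⟨h.isStem.mono (Set.preimage_mono hT), fun I hI z hz => h.eq I hI z (hT hz)⟩

theorem normalized_im_mem_imagUnits {q : ℍ} (h : q.im ≠ 0) : ‖q.im‖⁻¹ • q.im ∈ imagUnits := by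
  have hn : ‖q.im‖ ≠ 0 := norm_ne_zero_iff.2 h
  have hsq : ‖q.im‖ ^ 2 = q.imI ^ 2 + q.imJ ^ 2 + q.imK ^ 2 := by
    rw [sq, ← Quaternion.normSq_eq_norm_mul_self, Quaternion.normSq_def']
    simp
  refine mem_imagUnits_of_coords (by simp) ?_
  simp
  field_simp
  linarith

theorem sliceMap_normalized_im {q : ℍ} (h : q.im ≠ 0) :
    sliceMap (‖q.im‖⁻¹ • q.im) ⟨q.re, ‖q.im‖⟩ = q := by
  simp only [sliceMap]
  rw [Quaternion.mul_coe_eq_smul, smul_smul, mul_inv_cancel₀ (norm_ne_zero_iff.2 h), one_smul,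
    q.re_add_im]

theorem exists_sliceMap_eq (q : ℍ) :
    ∃ I ∈ imagUnits, sliceMap I ⟨q.re, ‖q.im‖⟩ = q := by
  by_cases h : q.im = 0
  · refine ⟨unitI, unitI_mem, ?_⟩
    rw [h]
    conv_rhs => rw [← q.re_add_im, h]
    simp [sliceMap]
  · exact ⟨_, normalized_im_mem_imagUnits h, sliceMap_normalized_im h⟩

/-- The slice function induced by a stem function. -/
def sliceExtension (Φ : ℂ → ℍ[ℂ]) (q : ℍ) : ℍ :=
  evalUnit (exists_sliceMap_eq q).choose (Φ ⟨q.re, ‖q.im‖⟩)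

/-- A nonreal quaternion determines the pair `(I, z)` up to `(-I, conj z)`, a change absorbed by the
conjugation symmetry of the stem. At a real point `I` is arbitrary, but there the same symmetry
kills the imaginary part of the stem. -/
theorem IsStem.evalUnit_eq_of_sliceMap_eq {D : Set ℂ} {Φ : ℂ → ℍ[ℂ]} (hΦ : IsStem D Φ)
    {I J : ℍ} (hI : I ∈ imagUnits) (hJ : J ∈ imagUnits) {z w : ℂ} (hz : z ∈ D)
    (h : sliceMap I z = sliceMap J w) : evalUnit I (Φ z) = evalUnit J (Φ w) := by
  have hre : z.re = w.re := by
    have := congrArg QuaternionAlgebra.re h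
    simpa [hI, hJ] using this
  have hn : z.im ^ 2 = w.im ^ 2 := by
    have := congrArg Quaternion.normSq h
    rw [normSq_sliceMap hI, normSq_sliceMap hJ, Complex.normSq_apply, Complex.normSq_apply,
      hre] at this
    nlinarith
  have hIJ : I * (z.im : ℍ) = J * (w.im : ℍ) := by
    simpa [sliceMap, hre] using h
  by_cases h0 : z.im = 0
  · have hw : w = z := by
      apply Complex.ext hre.symm
      rw [h0] at hn ⊢
      nlinarith
    have hr : star z = z := Complex.ext rfl (by simp [h0])
    have him : imPart (Φ z) = 0 := by
      have := congrArg imPart (hΦ.conj z hz)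
      rw [hr, imPart_complexConj] at this
      have h2 : (2 : ℝ) • imPart (Φ z) = 0 := by
        rw [two_smul]
        exact eq_neg_iff_add_eq_zero.1 this
      exact (smul_eq_zero.1 h2).resolve_left two_ne_zero
    rw [hw, evalUnit, evalUnit, him]; simp
  · have hz0 : (z.im : ℍ) ≠ 0 := fun e =>
      h0 (by simpa using congrArg QuaternionAlgebra.re e)
    rcases sq_eq_sq_iff_eq_or_eq_neg.1 hn with h1 | h1
    · have hw : w = z := Complex.ext hre.symm h1.symm
      rw [← h1] at hIJ
      rw [hw, mul_right_cancel₀ hz0 hIJ]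
    · have hw : w = star z := Complex.ext hre.symm (by simp; linarith)
      have hJ' : I = -J := by
        apply mul_right_cancel₀ hz0
        rw [hIJ, h1]; simp
      rw [hw, hΦ.conj z hz, evalUnit_complexConj, hJ']

theorem IsStem.isInducedBy {T : Set ℍ} {Φ : ℂ → ℍ[ℂ]} (hΦ : IsStem (profile T) Φ) :
    IsInducedBy T (sliceExtension Φ) Φ where
  isStem := hΦ
  eq I hI z hz := by
    have h := (exists_sliceMap_eq (sliceMap I z)).choose_spec
    exact (hΦ.evalUnit_eq_of_sliceMap_eq hI h.1 hz h.2.symm).symm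

/-! ### Slice regular functions are induced by stem functions -/

/-- Real points accumulate at `r`, so the identity theorem applies to the two complex coordinates
along `1` and an orthogonal unit `J`, which together determine the quaternion. -/
theorem HolomorphicFor.eqOn_of_eq_real {I : ℍ} (hI : I ∈ imagUnits) {D : Set ℂ} (hD : IsOpen D)
    (hc : IsPreconnected D) {u v : ℂ → ℍ} (hu : HolomorphicFor I D u) (hv : HolomorphicFor I D v)
    {r : ℝ} (hr : (r : ℂ) ∈ D) (huv : ∀ t : ℝ, (t : ℂ) ∈ D → u t = v t) : Set.EqOn u v D := by
  obtain ⟨J, hJ, hIJ⟩ := exists_orthogonal_imagUnit hI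
  have hev : ∀ᶠ t : ℝ in nhdsWithin r {r}ᶜ, u t = v t := by
    have h1 : ∀ᶠ t : ℝ in nhds r, (t : ℂ) ∈ D :=
      Complex.continuous_ofReal.continuousAt.eventually (hD.mem_nhds hr)
    exact (h1.filter_mono nhdsWithin_le_nhds).mono huv
  have htend : Filter.Tendsto (fun t : ℝ => (t : ℂ)) (nhdsWithin r {r}ᶜ)
      (nhdsWithin (r : ℂ) {(r : ℂ)}ᶜ) := by
    refine tendsto_nhdsWithin_iff.2
      ⟨Complex.continuous_ofReal.continuousAt.tendsto.mono_left nhdsWithin_le_nhds, ?_⟩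
    filter_upwards [self_mem_nhdsWithin] with t ht
    simpa using ht
  have hfreq : ∃ᶠ z : ℂ in nhdsWithin (r : ℂ) {(r : ℂ)}ᶜ, u z = v z :=
    htend.frequently hev.frequently
  have key : ∀ w : ℍ, Set.EqOn (fun z => sliceCoord I w (u z)) (fun z => sliceCoord I w (v z)) D :=
    fun w => ((hu.differentiableOn_sliceCoord hI hD w).analyticOnNhd hD).eqOn_of_preconnected_of_frequently_eq
      ((hv.differentiableOn_sliceCoord hI hD w).analyticOnNhd hD) hc hr
      (hfreq.mono fun z hz => by simp only [hz])
  exact fun z hz => eq_of_sliceCoord_eq hI hJ hIJ (key 1 hz) (key J hz)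

theorem isPreconnected_profile {Ω : Set ℍ} (hΩ : IsSliceDomain Ω) : IsPreconnected (profile Ω) := by
  have h : profile Ω = sliceCoord unitI 1 '' slice Ω unitI := by
    have e : ∀ z, sliceCoord unitI 1 (sliceMap unitI z) = z := fun z => by
      simpa using (sliceCoord_splitting unitI_mem unitJ_mem inner_unitI_unitJ z 0).1
    ext z
    constructor
    · intro hz
      exact ⟨sliceMap unitI z, ⟨hz, z, rfl⟩, e z⟩
    · rintro ⟨_, ⟨hq, w, rfl⟩, rfl⟩
      rw [e]
      exact hq
  rw [h]
  exact (hΩ.slice_isConnected unitI unitI_mem).isPreconnected.image _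
    (sliceCoord unitI 1).continuous.continuousOn

theorem differentiableOn_star_comp_star {D : Set ℂ} (hD : IsOpen D) (hs : ∀ z ∈ D, star z ∈ D)
    {F : ℂ → ℂ} (hF : DifferentiableOn ℂ F D) :
    DifferentiableOn ℂ (fun z => star (F (star z))) D := by
  intro z hz
  have h := (hF.differentiableAt (hD.mem_nhds (hs z hz))).star_star
  rw [star_star] at h
  exact h.differentiableWithinAt

/-- A stem is built from the restriction of `f` to the single slice of `i`. On any other slice, its
induced function and `f` are both holomorphic and agree at real points, hence agree by the identity
theorem. -/
theorem SliceRegular.exists_isInducedBy {Ω : Set ℍ} (hΩ : IsSymmetricSliceDomain Ω) {f : ℍ → ℍ}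
    (hf : SliceRegular Ω f) : ∃ Φ, IsInducedBy Ω f Φ := by
  have hD := isOpen_profile hΩ.isOpen
  have hs : ∀ z ∈ profile Ω, star z ∈ profile Ω := fun z hz => hΩ.symmetric.star_mem_profile hz
  have hol : ∀ I ∈ imagUnits, HolomorphicFor I (profile Ω) (fun z => f (sliceMap I z)) := by
    intro I hI
    rw [← hΩ.symmetric.preimage hI]
    exact (holomorphicOnSlice_iff hI).1 (hf I hI)
  set F : ℂ → ℂ := fun z => sliceCoord unitI 1 (f (sliceMap unitI z))
  set G : ℂ → ℂ := fun z => sliceCoord unitI unitJ (f (sliceMap unitI z))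
  have hF : DifferentiableOn ℂ F (profile Ω) := (hol _ unitI_mem).differentiableOn_sliceCoord unitI_mem hD 1
  have hG : DifferentiableOn ℂ G (profile Ω) := (hol _ unitI_mem).differentiableOn_sliceCoord unitI_mem hD unitJ
  have hF' := differentiableOn_star_comp_star hD hs hF
  have hG' := differentiableOn_star_comp_star hD hs hG
  -- On the slice of `i`, `f = F + G j`. Write `F = α + β i` and `G = γ + δ i` with each of the four
  -- functions commuting with conjugation; since `i j = k`, they are the coordinates of the stem
  -- along `1, i, j, k`.
  obtain ⟨Φ, r0, r1, r2, r3⟩ : ∃ Φ : ℂ → ℍ[ℂ],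
      (∀ z, (Φ z).re = (F z + star (F (star z))) / 2) ∧
      (∀ z, (Φ z).imI = -Complex.I * (F z - star (F (star z))) / 2) ∧
      (∀ z, (Φ z).imJ = (G z + star (G (star z))) / 2) ∧
      (∀ z, (Φ z).imK = -Complex.I * (G z - star (G (star z))) / 2) :=
    ⟨fun z => ⟨_, _, _, _⟩, fun _ => rfl, fun _ => rfl, fun _ => rfl, fun _ => rfl⟩
  have hΦ : IsStem (profile Ω) Φ :=
    { re := by simp only [r0]; exact (hF.add hF').div_const 2
      imI := by simp only [r1]; exact ((hF.sub hF').const_mul (-Complex.I)).div_const 2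
      imJ := by simp only [r2]; exact (hG.add hG').div_const 2
      imK := by simp only [r3]; exact ((hG.sub hG').const_mul (-Complex.I)).div_const 2
      conj := fun z _ => by
        ext1
        · rw [complexConj_re, r0, r0]; simp; ring
        · rw [complexConj_imI, r1, r1]; simp; ring
        · rw [complexConj_imJ, r2, r2]; simp; ring
        · rw [complexConj_imK, r3, r3]; simp; ring }
  have heval : ∀ z, f (sliceMap unitI z) = evalUnit unitI (Φ z) := by
    intro z
    have hK : unitK = unitI * unitJ := by ext <;> simp
    have e1 : (F z + star (F (star z))) / 2
        + -Complex.I * (F z - star (F (star z))) / 2 * Complex.I = F z := by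
      linear_combination (-(F z - star (F (star z))) / 2) * Complex.I_mul_I
    have e2 : (G z + star (G (star z))) / 2
        + -Complex.I * (G z - star (G (star z))) / 2 * Complex.I = G z := by
      linear_combination (-(G z - star (G (star z))) / 2) * Complex.I_mul_I
    have e3 : evalUnit unitI (Φ z) = sliceMap unitI (F z) + sliceMap unitI (G z) * unitJ := by
      rw [evalUnit_eq_sum, hK, r0, r1, r2, r3]
      conv_rhs => rw [← e1, ← e2]
      rw [sliceMap_add, sliceMap_add, sliceMap_mul unitI_mem _ Complex.I,
        sliceMap_mul unitI_mem _ Complex.I, sliceMap_I]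
      noncomm_ring
    rw [e3]
    exact sliceMap_sliceCoord unitI_mem unitJ_mem inner_unitI_unitJ _
  refine ⟨Φ, hΦ, fun I hI => ?_⟩
  obtain ⟨r, hr⟩ := hΩ.meets_real
  have hr' : (r : ℂ) ∈ profile Ω := by
    simpa [profile] using hr
  exact (hol I hI).eqOn_of_eq_real hI hD (isPreconnected_profile hΩ.toIsSliceDomain)
    (hΦ.holomorphicFor hD hI) hr' fun t ht => by
      rw [← hΦ.evalUnit_eq_of_sliceMap_eq unitI_mem hI ht (w := (t : ℂ)) (by simp), ← heval]
      simp

/-! ### Splittings -/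

theorem isSplitting_sliceCoord {T : Set ℍ} (hT : IsOpen T) {f : ℍ → ℍ} {I J : ℍ}
    (hI : I ∈ imagUnits) (hJ : J ∈ imagUnits) (hIJ : inner ℝ I J = 0)
    (hf : HolomorphicOnSlice T I f) :
    IsSplitting T I J f (fun q => sliceMap I (sliceCoord I 1 (f q)))
      (fun q => sliceMap I (sliceCoord I J (f q))) := by
  have hD : IsOpen (sliceMap I ⁻¹' T) := hT.preimage (sliceCLM I).continuous
  have h := (holomorphicOnSlice_iff hI).1 hf
  exact
    { holo_left := (holomorphicOnSlice_iff hI).2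
        (HolomorphicFor.sliceMap_comp hI hD (h.differentiableOn_sliceCoord hI hD 1))
      holo_right := (holomorphicOnSlice_iff hI).2
        (HolomorphicFor.sliceMap_comp hI hD (h.differentiableOn_sliceCoord hI hD J))
      mapsTo_left := fun q _ => ⟨_, rfl⟩
      mapsTo_right := fun q _ => ⟨_, rfl⟩
      eq_add := fun q _ => sliceMap_sliceCoord hI hJ hIJ (f q) }

theorem star_mem_slice {T : Set ℍ} (hT : AxiallySymmetric T) {I : ℍ} (hI : I ∈ imagUnits) {w : ℂ}
    (hw : w ∈ profile T) : star (sliceMap I w) ∈ slice T I := by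
  rw [star_sliceMap hI]
  exact ⟨(hT.mem_profile hI).1 (hT.star_mem_profile hw), _, rfl⟩

theorem IsInducedBy.apply_star {T : Set ℍ} {f : ℍ → ℍ} {P : ℂ → ℍ[ℂ]} (h : IsInducedBy T f P)
    (hT : AxiallySymmetric T) {I : ℍ} (hI : I ∈ imagUnits) {w : ℂ} (hw : w ∈ profile T) :
    f (star (sliceMap I w)) = evalUnit (-I) (P w) := by
  rw [star_sliceMap hI, h.eq I hI _ (hT.star_mem_profile hw), h.isStem.conj w hw,
    evalUnit_complexConj]

theorem mul_unit_comm {I F : ℍ} (hF : F ∈ slicePlane I) : I * F = F * I := by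
  obtain ⟨z, rfl⟩ := hF
  rw [sliceMap, mul_add, add_mul, coe_mul_comm z.re I, mul_assoc, coe_mul_comm z.im I]

theorem orthogonal_mul_comm {I J F : ℍ} (hI : I ∈ imagUnits) (hJ : J ∈ imagUnits)
    (hIJ : inner ℝ I J = 0) (hF : F ∈ slicePlane I) : J * F = star F * J := by
  obtain ⟨z, rfl⟩ := hF
  rw [sliceMap_mul_orthogonal hI hJ hIJ, star_sliceMap hI]

theorem star_mem_slicePlane {I F : ℍ} (hI : I ∈ imagUnits) (hF : F ∈ slicePlane I) :
    star F ∈ slicePlane I := by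
  obtain ⟨z, rfl⟩ := hF
  exact ⟨star z, (star_sliceMap hI z).symm⟩

/-- `F` commutes with `I` while `G J` anticommutes with it, so moving `I` past `G J` replaces `I` by
`-I` in the second factor. The value at `-I` is the value at the conjugate point, hence the terms in
`conj z` of the `*`-product. -/
theorem evalUnit_mul_of_splitting {I J F G : ℍ} (hI : I ∈ imagUnits) (hJ : J ∈ imagUnits)
    (hIJ : inner ℝ I J = 0) (hF : F ∈ slicePlane I) (hG : G ∈ slicePlane I) {P : ℍ[ℂ]}
    (hP : evalUnit I P = F + G * J) (Q : ℍ[ℂ]) :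
    evalUnit I (P * Q) = F * evalUnit I Q + G * J * evalUnit (-I) Q := by
  have h : I * (F + G * J) = F * I - G * J * I := by
    calc I * (F + G * J) = I * F + (I * G) * J := by noncomm_ring
      _ = F * I + G * (I * J) := by rw [mul_unit_comm hF, mul_unit_comm hG]; noncomm_ring
      _ = F * I - G * J * I := by
        rw [mul_assoc G J I, orthogonal_anticomm hI hJ hIJ]; noncomm_ring
  rw [evalUnit_mul hI, hP, h, evalUnit, evalUnit]
  noncomm_ring

theorem starProduct_formula_eq {I J F G H K H' K' : ℍ} (hI : I ∈ imagUnits) (hJ : J ∈ imagUnits)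
    (hIJ : inner ℝ I J = 0) (hH' : H' ∈ slicePlane I) (hK' : K' ∈ slicePlane I) :
    (F * H - G * star K') + (F * K + G * star H') * J
      = F * (H + K * J) + G * J * (H' + K' * J) := by
  have e : G * J * (H' + K' * J) = G * (J * H') + G * (J * K') * J := by noncomm_ring
  rw [e, orthogonal_mul_comm hI hJ hIJ hH', orthogonal_mul_comm hI hJ hIJ hK']
  have e2 : G * (star K' * J) * J = -(G * star K') := by
    rw [← mul_assoc, mul_assoc _ J J, mem_imagUnits_iff_mul_self.1 hJ]; simp
  rw [e2]
  noncomm_ring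

theorem evalUnit_star_of_splitting {I J F G F' G' : ℍ} (hI : I ∈ imagUnits) (hJ : J ∈ imagUnits)
    (hIJ : inner ℝ I J = 0) (hF : F ∈ slicePlane I) (hG : G ∈ slicePlane I)
    (hF' : F' ∈ slicePlane I) (hG' : G' ∈ slicePlane I) {P : ℍ[ℂ]}
    (hP : evalUnit I P = F + G * J) (hP' : evalUnit (-I) P = F' + G' * J) :
    evalUnit I (star P) = star F' - G * J := by
  have hII := mem_imagUnits_iff_mul_self.1 hI
  rw [evalUnit] at hP hP'
  rw [evalUnit, rePart_star, imPart_star]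
  generalize rePart P = a at *
  generalize imPart P = b at *
  have sJ : ∀ {X : ℍ}, X ∈ slicePlane I → star (X * J) = -(X * J) := by
    intro X hX
    rw [star_mul, star_imagUnits hJ, neg_mul,
      orthogonal_mul_comm hI hJ hIJ (star_mem_slicePlane hI hX), star_star]
  have e1 : star a - star b * I = star F - G * J := by
    have := congrArg star hP
    rw [star_add, star_add, sJ hG, star_mul, star_imagUnits hI] at this
    rw [sub_eq_add_neg, sub_eq_add_neg, ← this]; noncomm_ring
  have e2 : star a + star b * I = star F' - G' * J := by
    have := congrArg star hP'
    rw [star_add, star_add, sJ hG', star_mul, star_neg, star_imagUnits hI, neg_neg] at this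
    rw [this]; noncomm_ring
  have cX : ∀ {X : ℍ}, X ∈ slicePlane I → I * star X * I = -star X := by
    intro X hX
    rw [mul_unit_comm (star_mem_slicePlane hI hX), mul_assoc, hII]; simp
  have cY : ∀ {X : ℍ}, X ∈ slicePlane I → I * (X * J) * I = X * J := by
    intro X hX
    calc I * (X * J) * I = (I * X) * (J * I) := by noncomm_ring
      _ = -(X * (I * I) * J) := by
        rw [mul_unit_comm hX, orthogonal_anticomm hI hJ hIJ]; noncomm_ring
      _ = X * J := by rw [hII]; noncomm_ring
  have e3 : I * (star b * I) * I = -(I * star b) := by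
    rw [mul_assoc, mul_assoc (star b), hII]; simp
  have e4 : (2 : ℝ) • (star b * I) = star F' - G' * J - (star F - G * J) := by
    rw [← e1, ← e2, two_smul]; abel
  have e5 : (2 : ℝ) • (I * star b) = star F' + G' * J - (star F + G * J) := by
    -- Conjugating a splitting yields `star b * I`, whereas evaluating `star P` needs `I * star b`.
    -- The map `x ↦ -(I x I)` exchanges them; it fixes `ℝ + I ℝ` and changes the sign of its
    -- multiples by `J`.
    have h := congrArg (fun x => -(I * x * I)) e4
    simp only [mul_smul_comm, smul_mul_assoc, mul_sub, sub_mul, cX hF, cX hF', cY hG, cY hG',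
      e3] at h
    rw [smul_neg, neg_neg] at h
    rw [h]; abel
  have e6 : (2 : ℝ) • (star a + I * star b) = (2 : ℝ) • (star F' - G * J) := by
    have e7 : (2 : ℝ) • star a = star F' - G' * J + (star F - G * J) := by
      rw [← e1, ← e2, two_smul]; abel
    rw [smul_add, e5, e7, two_smul]; abel
  exact smul_right_injective ℍ (two_ne_zero (α := ℝ)) e6

/-! ### Products and conjugates of induced functions -/

section products

variable {T : Set ℍ} {f g k : ℍ → ℍ} {P Q : ℂ → ℍ[ℂ]}

/-- Valid for arbitrary splittings, so it serves both to produce a `*`-product and to identify the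
values of any given one. -/
theorem IsInducedBy.starProduct_formula (hs : AxiallySymmetric T) (hf : IsInducedBy T f P)
    (hg : IsInducedBy T g Q) {I J : ℍ} (hI : I ∈ imagUnits) (hJ : J ∈ imagUnits)
    (hIJ : inner ℝ I J = 0) {F G H K : ℍ → ℍ} (hFG : IsSplitting T I J f F G)
    (hHK : IsSplitting T I J g H K) {w : ℂ} (hw : w ∈ profile T) :
    (F (sliceMap I w) * H (sliceMap I w) - G (sliceMap I w) * star (K (star (sliceMap I w))))
      + (F (sliceMap I w) * K (sliceMap I w) + G (sliceMap I w) * star (H (star (sliceMap I w)))) * J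
      = evalUnit I (P w * Q w) := by
  have hz : sliceMap I w ∈ slice T I := ⟨(hs.mem_profile hI).1 hw, w, rfl⟩
  have hz' := star_mem_slice hs hI hw
  rw [starProduct_formula_eq hI hJ hIJ (hHK.mapsTo_left hz') (hHK.mapsTo_right hz'),
    ← hHK.eq_add _ hz, ← hHK.eq_add _ hz', hg.apply_star hs hI hw, hg.eq I hI w hw]
  refine (evalUnit_mul_of_splitting hI hJ hIJ (hFG.mapsTo_left hz) (hFG.mapsTo_right hz) ?_ _).symm
  rw [← hf.eq I hI w hw, hFG.eq_add _ hz]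

theorem IsInducedBy.isStarProduct (hT : IsOpen T) (hs : AxiallySymmetric T)
    (hf : IsInducedBy T f P) (hg : IsInducedBy T g Q)
    (hk : IsInducedBy T k (fun z => P z * Q z)) : IsStarProduct T f g k := by
  refine ⟨hk.sliceRegular hT hs, fun I hI J hJ hIJ => ?_⟩
  have hFG := isSplitting_sliceCoord hT hI hJ hIJ (hf.sliceRegular hT hs I hI)
  have hHK := isSplitting_sliceCoord hT hI hJ hIJ (hg.sliceRegular hT hs I hI)
  refine ⟨_, _, _, _, hFG, hHK, ?_⟩
  rintro _ ⟨hz, w, rfl⟩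
  have hw := (hs.mem_profile hI).2 hz
  rw [hk.eq I hI w hw]
  exact (hf.starProduct_formula hs hg hI hJ hIJ hFG hHK hw).symm

/-- Uniqueness on `T`: whichever function `starProduct` chooses, its values there are forced by the
product of the stems. -/
theorem IsStarProduct.isInducedBy (h : IsStarProduct T f g k) (hs : AxiallySymmetric T)
    (hf : IsInducedBy T f P) (hg : IsInducedBy T g Q) :
    IsInducedBy T k (fun z => P z * Q z) := by
  refine ⟨hf.isStem.mul hg.isStem, fun I hI w hw => ?_⟩
  obtain ⟨J, hJ, hIJ⟩ := exists_orthogonal_imagUnit hI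
  obtain ⟨F, G, H, K, hFG, hHK, e⟩ := h.2 I hI J hJ hIJ
  rw [e _ ⟨(hs.mem_profile hI).1 hw, w, rfl⟩]
  exact hf.starProduct_formula hs hg hI hJ hIJ hFG hHK hw

theorem IsInducedBy.isStarProduct_starProduct (hT : IsOpen T) (hs : AxiallySymmetric T)
    (hf : IsInducedBy T f P) (hg : IsInducedBy T g Q) :
    IsStarProduct T f g (starProduct T f g) := by
  have h : ∃ k, IsStarProduct T f g k :=
    ⟨_, hf.isStarProduct hT hs hg (hf.isStem.mul hg.isStem).isInducedBy⟩
  rw [starProduct, dif_pos h]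
  exact h.choose_spec

theorem IsInducedBy.starProduct (hT : IsOpen T) (hs : AxiallySymmetric T)
    (hf : IsInducedBy T f P) (hg : IsInducedBy T g Q) :
    IsInducedBy T (starProduct T f g) (fun z => P z * Q z) :=
  (hf.isStarProduct_starProduct hT hs hg).isInducedBy hs hf hg

theorem IsInducedBy.regularConj_formula (hs : AxiallySymmetric T) (hf : IsInducedBy T f P)
    {I J : ℍ} (hI : I ∈ imagUnits) (hJ : J ∈ imagUnits) (hIJ : inner ℝ I J = 0) {F G : ℍ → ℍ}
    (hFG : IsSplitting T I J f F G) {w : ℂ} (hw : w ∈ profile T) :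
    star (F (star (sliceMap I w))) - G (sliceMap I w) * J = evalUnit I (star (P w)) := by
  have hz : sliceMap I w ∈ slice T I := ⟨(hs.mem_profile hI).1 hw, w, rfl⟩
  have hz' := star_mem_slice hs hI hw
  refine (evalUnit_star_of_splitting hI hJ hIJ (hFG.mapsTo_left hz) (hFG.mapsTo_right hz)
    (hFG.mapsTo_left hz') (hFG.mapsTo_right hz') ?_ ?_).symm
  · rw [← hf.eq I hI w hw, hFG.eq_add _ hz]
  · rw [← hf.apply_star hs hI hw, hFG.eq_add _ hz']

theorem IsInducedBy.isRegularConj_regularConj (hT : IsOpen T) (hs : AxiallySymmetric T)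
    (hf : IsInducedBy T f P) : IsRegularConj T f (regularConj T f) := by
  have h : ∃ k, IsRegularConj T f k := by
    have hk := hf.isStem.conjugate.isInducedBy
    refine ⟨_, hk.sliceRegular hT hs, fun I hI J hJ hIJ => ?_⟩
    have hFG := isSplitting_sliceCoord hT hI hJ hIJ (hf.sliceRegular hT hs I hI)
    refine ⟨_, _, hFG, ?_⟩
    rintro _ ⟨hz, w, rfl⟩
    have hw := (hs.mem_profile hI).2 hz
    rw [hk.eq I hI w hw]
    exact (hf.regularConj_formula hs hI hJ hIJ hFG hw).symm
  rw [regularConj, dif_pos h]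
  exact h.choose_spec

theorem IsInducedBy.regularConj (hT : IsOpen T) (hs : AxiallySymmetric T)
    (hf : IsInducedBy T f P) : IsInducedBy T (regularConj T f) (fun z => star (P z)) := by
  refine ⟨hf.isStem.conjugate, fun I hI w hw => ?_⟩
  obtain ⟨J, hJ, hIJ⟩ := exists_orthogonal_imagUnit hI
  obtain ⟨F, G, hFG, e⟩ := (hf.isRegularConj_regularConj hT hs).2 I hI J hJ hIJ
  rw [e _ ⟨(hs.mem_profile hI).1 hw, w, rfl⟩]
  exact hf.regularConj_formula hs hI hJ hIJ hFG hw

end products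

/-! ### Smoothness of induced functions -/

/-- Conjugation symmetry makes the Taylor series at a real point real. Such a series also converges
in `ℍ`, and `sliceMap I`, being a continuous homomorphism of real algebras, carries the complex sum
to the quaternionic one for all `I` at once. -/
theorem exists_contDiffAt_extension_of_real {D : Set ℂ} (hD : IsOpen D) {φ : ℂ → ℂ}
    (hφ : DifferentiableOn ℂ φ D) (hs : ∀ z ∈ D, φ (star z) = star (φ z)) {r : ℝ}
    (hr : (r : ℂ) ∈ D) :
    ∃ S : ℍ → ℍ, ContDiffAt ℝ ∞ S (r : ℍ) ∧
      ∀ᶠ z in nhds (r : ℂ), ∀ I ∈ imagUnits, sliceMap I (φ z) = S (sliceMap I z) := by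
  obtain ⟨P, ρ, hP⟩ := hφ.analyticOnNhd hD r hr
  set c : ℕ → ℝ := fun n => (P.coeff n).re with hc
  set p : FormalMultilinearSeries ℝ ℍ ℍ := FormalMultilinearSeries.ofScalars ℍ c with hp
  have hrad : 0 < p.radius := by
    refine lt_of_lt_of_le (hP.r_pos.trans_le hP.r_le) (FormalMultilinearSeries.radius_le_of_le ?_)
    intro n
    rw [hp, FormalMultilinearSeries.ofScalars_norm,
      FormalMultilinearSeries.norm_apply_eq_norm_coef]
    exact Complex.abs_re_le_norm _
  refine ⟨fun q => p.sum (q - r), ?_, ?_⟩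
  · have h := (p.hasFPowerSeriesOnBall hrad).analyticAt.contDiffAt (n := ∞)
    refine ContDiffAt.comp (r : ℍ) (f := fun q : ℍ => q - r) (g := p.sum) ?_
      (contDiffAt_id.sub contDiffAt_const)
    simpa using h
  · have hev : ∀ᶠ z in nhds (r : ℂ), z ∈ Metric.eball (r : ℂ) ρ :=
      Metric.isOpen_eball.mem_nhds (Metric.mem_eball_self hP.r_pos)
    have hstar : Filter.Tendsto (star : ℂ → ℂ) (nhds (r : ℂ)) (nhds (r : ℂ)) := by
      have := (continuous_star (R := ℂ)).tendsto (r : ℂ)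
      simpa using this
    filter_upwards [hev, hstar.eventually hev, hD.mem_nhds hr] with z hz hz' hzD I hI
    have h1 := hP.hasSum_sub hz
    have h2 := (hP.hasSum_sub hz').star
    rw [hs z hzD, star_star] at h2
    -- Averaging the expansion at `z` with the conjugate of the one at `conj z` replaces the
    -- coefficients by their real parts `c n`, so their reality need not be proved separately.
    have h3 := (h1.add h2).mul_left (1 / 2)
    have h4 : HasSum (fun n => (c n : ℂ) * (z - r) ^ n) (φ z) := by
      convert! h3 using 1
      · funext n
        rw [FormalMultilinearSeries.apply_eq_pow_smul_coeff,
          FormalMultilinearSeries.apply_eq_pow_smul_coeff]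
        have e : (c n : ℂ) = (P.coeff n + star (P.coeff n)) / 2 := by
          rw [hc]; exact Complex.re_eq_add_conj _
        rw [e]
        simp
        ring
      · ring
    have h5 := (sliceCLM I).hasSum h4
    rw [FormalMultilinearSeries.sum, ← sliceCLM_apply, ← h5.tsum_eq]
    refine tsum_congr fun n => ?_
    rw [hp, FormalMultilinearSeries.ofScalars_apply_eq, sliceCLM_apply,
      sliceMap_mul hI, sliceMap_pow hI, sliceMap_sub, sliceMap_ofReal, sliceMap_ofReal,
      Quaternion.coe_mul_eq_smul]

theorem contDiff_quaternion_re : ContDiff ℝ ∞ (fun q : ℍ => q.re) := by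
  have h := (innerSL ℝ (1 : ℍ)).contDiff (n := ∞)
  convert! h using 1
  funext q
  rw [innerSL_apply_apply, inner_eq_sum_coords]
  simp

theorem contDiff_quaternion_im : ContDiff ℝ ∞ (fun q : ℍ => q.im) := by
  have h : (fun q : ℍ => q.im) = fun q => q - q.re • (1 : ℍ) := by
    funext q
    rw [eq_sub_iff_add_eq, add_comm]
    conv_rhs => rw [← q.re_add_im]
    rw [← Quaternion.mul_coe_eq_smul, one_mul]
  rw [h]
  exact contDiff_id.sub (contDiff_quaternion_re.smul contDiff_const)

/-- The complex number `x + i |y|` for `q = x + I y`. -/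
def quaternionModulus (q : ℍ) : ℂ := ⟨q.re, ‖q.im‖⟩

theorem continuous_quaternionModulus : Continuous quaternionModulus := by
  have h : quaternionModulus = fun q => (q.re : ℂ) + (‖q.im‖ : ℂ) * Complex.I := by
    funext q
    exact (Complex.mk_eq_add_mul_I _ _)
  rw [h]
  exact (Complex.continuous_ofReal.comp contDiff_quaternion_re.continuous).add
    ((Complex.continuous_ofReal.comp contDiff_quaternion_im.continuous.norm).mul continuous_const)

theorem contDiffAt_quaternionModulus {q : ℍ} (hq : q.im ≠ 0) :
    ContDiffAt ℝ ∞ quaternionModulus q := by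
  have h : quaternionModulus = fun q => (q.re : ℂ) + (‖q.im‖ : ℂ) * Complex.I := by
    funext q
    exact (Complex.mk_eq_add_mul_I _ _)
  rw [h]
  exact (Complex.ofRealCLM.contDiff.contDiffAt.comp q contDiff_quaternion_re.contDiffAt).add
    ((Complex.ofRealCLM.contDiff.contDiffAt.comp q
      (contDiff_quaternion_im.contDiffAt.norm ℝ hq)).mul contDiffAt_const)

theorem contDiffAt_sliceMap {q : ℍ} {u : ℍ → ℍ} {c : ℍ → ℂ} (hu : ContDiffAt ℝ ∞ u q)
    (hc : ContDiffAt ℝ ∞ c q) : ContDiffAt ℝ ∞ (fun q => sliceMap (u q) (c q)) q := by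
  have h : (fun q => sliceMap (u q) (c q)) = fun q => (c q).re • (1 : ℍ) + (c q).im • u q := by
    funext q
    rw [sliceMap, Quaternion.mul_coe_eq_smul, ← Quaternion.coe_mul_eq_smul (c q).re, mul_one]
  rw [h]
  exact ((Complex.reCLM.contDiff.contDiffAt.comp q hc).smul contDiffAt_const).add
    ((Complex.imCLM.contDiff.contDiffAt.comp q hc).smul hu)

theorem IsInducedBy.contDiffAt_of_im_ne_zero {T : Set ℍ} {f : ℍ → ℍ} {Φ : ℂ → ℍ[ℂ]}
    (hf : IsInducedBy T f Φ) (hT : IsOpen T) (hs : AxiallySymmetric T) {q : ℍ} (hq : q ∈ T)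
    (him : q.im ≠ 0) : ContDiffAt ℝ ∞ f q := by
  have hD := isOpen_profile hT
  have hz : ∀ p ∈ T, p.im ≠ 0 → quaternionModulus p ∈ profile T := fun p hp h => by
    rw [hs.mem_profile (normalized_im_mem_imagUnits h), quaternionModulus, sliceMap_normalized_im h]
    exact hp
  have hu : ContDiffAt ℝ ∞ (fun p : ℍ => ‖p.im‖⁻¹ • p.im) q :=
    ((contDiff_quaternion_im.contDiffAt.norm ℝ him).inv (norm_ne_zero_iff.2 him)).smul
      contDiff_quaternion_im.contDiffAt
  have hcomp : ∀ {φ : ℂ → ℂ}, DifferentiableOn ℂ φ (profile T) → ∀ e : ℍ,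
      ContDiffAt ℝ ∞
        (fun p : ℍ => sliceMap (‖p.im‖⁻¹ • p.im) (φ (quaternionModulus p)) * e) q := by
    intro φ hφ e
    have h1 : ContDiffAt ℝ ∞ φ (quaternionModulus q) :=
      ((hφ.contDiffOn hD).restrict_scalars ℝ).contDiffAt (hD.mem_nhds (hz q hq him))
    exact (contDiffAt_sliceMap hu (h1.comp q (contDiffAt_quaternionModulus him))).mul
      contDiffAt_const
  have hsum := (((hcomp hf.isStem.re 1).add (hcomp hf.isStem.imI unitI)).add
    (hcomp hf.isStem.imJ unitJ)).add (hcomp hf.isStem.imK unitK)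
  refine hsum.congr_of_eventuallyEq ?_
  have hne : ∀ᶠ p : ℍ in nhds q, p.im ≠ 0 :=
    contDiff_quaternion_im.continuous.continuousAt.eventually_ne him
  filter_upwards [hne, hT.mem_nhds hq] with p h1 h2
  have := hf.eq _ (normalized_im_mem_imagUnits h1) _ (hz p h2 h1)
  rw [quaternionModulus, sliceMap_normalized_im h1] at this
  rw [this, evalUnit_eq_sum]
  rfl

/-- The norm of the imaginary part is not differentiable on the real axis, so the polar description
of `q` is replaced by the quaternionic power series of the four stem coordinates. -/
theorem IsInducedBy.contDiffAt_of_im_eq_zero {T : Set ℍ} {f : ℍ → ℍ} {Φ : ℂ → ℍ[ℂ]}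
    (hf : IsInducedBy T f Φ) (hT : IsOpen T) (hs : AxiallySymmetric T) {q : ℍ} (hq : q ∈ T)
    (him : q.im = 0) : ContDiffAt ℝ ∞ f q := by
  have hD := isOpen_profile hT
  obtain ⟨r, rfl⟩ : ∃ r : ℝ, q = r := ⟨q.re, by conv_lhs => rw [← q.re_add_im, him, add_zero]⟩
  have hr : (r : ℂ) ∈ profile T := by rw [hs.mem_profile unitI_mem]; simpa using hq
  have hconj := hf.isStem.conj
  obtain ⟨S0, c0, e0⟩ := exists_contDiffAt_extension_of_real hD hf.isStem.re
    (fun z hz => by rw [hconj z hz, complexConj_re]) hr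
  obtain ⟨S1, c1, e1⟩ := exists_contDiffAt_extension_of_real hD hf.isStem.imI
    (fun z hz => by rw [hconj z hz, complexConj_imI]) hr
  obtain ⟨S2, c2, e2⟩ := exists_contDiffAt_extension_of_real hD hf.isStem.imJ
    (fun z hz => by rw [hconj z hz, complexConj_imJ]) hr
  obtain ⟨S3, c3, e3⟩ := exists_contDiffAt_extension_of_real hD hf.isStem.imK
    (fun z hz => by rw [hconj z hz, complexConj_imK]) hr
  have hsum := (((c0.mul (contDiffAt_const (c := (1 : ℍ)))).add
    (c1.mul (contDiffAt_const (c := unitI)))).add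
    (c2.mul (contDiffAt_const (c := unitJ)))).add (c3.mul (contDiffAt_const (c := unitK)))
  refine hsum.congr_of_eventuallyEq ?_
  have hlim : Filter.Tendsto quaternionModulus (nhds (r : ℍ)) (nhds (r : ℂ)) := by
    have h := continuous_quaternionModulus.tendsto (r : ℍ)
    have e : quaternionModulus (r : ℍ) = (r : ℂ) := by
      apply Complex.ext <;> simp [quaternionModulus]
    rwa [e] at h
  filter_upwards [hlim.eventually e0, hlim.eventually e1, hlim.eventually e2, hlim.eventually e3,
    hlim.eventually (hD.mem_nhds hr)] with p h0 h1 h2 h3 hp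
  obtain ⟨I, hI, hIp⟩ := exists_sliceMap_eq p
  have := hf.eq I hI _ hp
  rw [evalUnit_eq_sum, h0 I hI, h1 I hI, h2 I hI, h3 I hI] at this
  rw [quaternionModulus, hIp] at this
  exact this

theorem IsInducedBy.contDiffOn {T : Set ℍ} {f : ℍ → ℍ} {Φ : ℂ → ℍ[ℂ]} (hf : IsInducedBy T f Φ)
    (hT : IsOpen T) (hs : AxiallySymmetric T) : ContDiffOn ℝ ∞ f T := by
  intro q hq
  by_cases h : q.im = 0
  · exact (hf.contDiffAt_of_im_eq_zero hT hs hq h).contDiffWithinAt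
  · exact (hf.contDiffAt_of_im_ne_zero hT hs hq h).contDiffWithinAt

theorem contDiffOn_quaternion_conj {T : Set ℍ} {p : ℍ → ℍ} (hp : ContDiffOn ℝ ∞ p T)
    (h0 : ∀ q ∈ T, p q ≠ 0) : ContDiffOn ℝ ∞ (fun q => (p q)⁻¹ * q * p q) T := by
  have hinv : ContDiffOn ℝ ∞ (fun q => (p q)⁻¹) T := by
    intro q hq
    have h := contDiffAt_ringInverse (n := ∞) ℝ (Units.mk0 (p q) (h0 q hq))
    rw [Ring.inverse_eq_inv'] at h
    exact h.comp_contDiffWithinAt q (hp q hq)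
  exact (hinv.mul contDiffOn_id).mul hp

/-! ### The reciprocal and the twist -/

theorem AxiallySymmetric.exists_sliceMap {T : Set ℍ} (hs : AxiallySymmetric T) {q : ℍ}
    (hq : q ∈ T) : ∃ I ∈ imagUnits, ∃ w ∈ profile T, sliceMap I w = q := by
  obtain ⟨I, hI, h⟩ := exists_sliceMap_eq q
  exact ⟨I, hI, _, (hs.mem_profile hI).2 (h.symm ▸ hq), h⟩

section reciprocal

variable {Ω : Set ℍ} {f g : ℍ → ℍ} {P Q : ℂ → ℍ[ℂ]}

theorem IsInducedBy.symmetrization (hΩ : IsOpen Ω) (hs : AxiallySymmetric Ω)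
    (hf : IsInducedBy Ω f P) : IsInducedBy Ω (symmetrization Ω f)
      (fun z => ((Quaternion.normSq (P z) : ℂ) : ℍ[ℂ])) := by
  simpa only [Quaternion.self_mul_star, SliceRegularity.symmetrization] using
    hf.starProduct hΩ hs (hf.regularConj hΩ hs)

theorem IsInducedBy.symmetrization_sliceMap (hΩ : IsOpen Ω) (hs : AxiallySymmetric Ω)
    (hf : IsInducedBy Ω f P) {I : ℍ} (hI : I ∈ imagUnits) {w : ℂ} (hw : w ∈ profile Ω) :
    SliceRegularity.symmetrization Ω f (sliceMap I w) = sliceMap I (Quaternion.normSq (P w)) := by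
  rw [(hf.symmetrization hΩ hs).eq I hI w hw, evalUnit_coe hI]

theorem IsInducedBy.sliceMap_mem_reciprocalDomain (hΩ : IsOpen Ω) (hs : AxiallySymmetric Ω)
    (hf : IsInducedBy Ω f P) {I : ℍ} (hI : I ∈ imagUnits) {w : ℂ} :
    sliceMap I w ∈ reciprocalDomain Ω f ↔ w ∈ profile Ω ∧ Quaternion.normSq (P w) ≠ 0 := by
  rw [hs.mem_profile hI]
  refine ⟨fun ⟨h1, h2⟩ => ⟨h1, fun h0 => h2 ⟨h1, ?_⟩⟩, fun ⟨h1, h2⟩ => ⟨h1, fun ⟨_, h0⟩ => h2 ?_⟩⟩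
  · rw [hf.symmetrization_sliceMap hΩ hs hI ((hs.mem_profile hI).2 h1), h0, sliceMap_zero]
  · rwa [hf.symmetrization_sliceMap hΩ hs hI ((hs.mem_profile hI).2 h1), sliceMap_eq_zero hI] at h0

theorem IsInducedBy.axiallySymmetric_reciprocalDomain (hΩ : IsOpen Ω) (hs : AxiallySymmetric Ω)
    (hf : IsInducedBy Ω f P) : AxiallySymmetric (reciprocalDomain Ω f) := fun x y _ hI h _ hJ =>
  (hf.sliceMap_mem_reciprocalDomain hΩ hs hJ (w := ⟨x, y⟩)).2
    ((hf.sliceMap_mem_reciprocalDomain hΩ hs hI (w := ⟨x, y⟩)).1 h)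

theorem IsInducedBy.isOpen_reciprocalDomain (hΩ : IsOpen Ω) (hs : AxiallySymmetric Ω)
    (hf : IsInducedBy Ω f P) : IsOpen (reciprocalDomain Ω f) := by
  have hc : ContinuousOn (SliceRegularity.symmetrization Ω f) Ω :=
    ((hf.symmetrization hΩ hs).contDiffOn hΩ hs).continuousOn
  have h : reciprocalDomain Ω f = Ω ∩ SliceRegularity.symmetrization Ω f ⁻¹' {0}ᶜ := by
    ext q
    simp [reciprocalDomain, zeroSet]
  rw [h]
  exact hc.isOpen_inter_preimage hΩ isOpen_compl_singleton

theorem reciprocalDomain_subset : reciprocalDomain Ω f ⊆ Ω := Set.sdiff_subset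

theorem IsInducedBy.regularReciprocal (hΩ : IsOpen Ω) (hs : AxiallySymmetric Ω)
    (hf : IsInducedBy Ω f P) :
    IsInducedBy (reciprocalDomain Ω f) (regularReciprocal Ω f)
      (fun z => (((Quaternion.normSq (P z))⁻¹ : ℂ) : ℍ[ℂ]) * star (P z)) := by
  have hmem : ∀ z ∈ profile (reciprocalDomain Ω f),
      z ∈ profile Ω ∧ Quaternion.normSq (P z) ≠ 0 := fun z hz =>
    (hf.sliceMap_mem_reciprocalDomain hΩ hs unitI_mem).1 hz
  have hstem := hf.isStem.mono fun z hz => (hmem z hz).1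
  refine ⟨IsStem.mul (IsStem.coe (hstem.normSq.inv fun z hz => (hmem z hz).2) fun z hz => ?_)
    hstem.conjugate, fun I hI z hz => ?_⟩
  · rw [hstem.normSq_conj hz, star_inv₀]
  · rw [SliceRegularity.regularReciprocal, hf.symmetrization_sliceMap hΩ hs hI (hmem z hz).1,
      (hf.regularConj hΩ hs).eq I hI z (hmem z hz).1, evalUnit_coe_mul hI, sliceMap_inv hI]

/-- A left factor vanishing at `I` makes the whole product vanish at `I`, but `star A * A` is the
nonzero scalar `normSq A`. -/
theorem evalUnit_star_ne_zero {I : ℍ} (hI : I ∈ imagUnits) {A : ℍ[ℂ]}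
    (hA : Quaternion.normSq A ≠ 0) : evalUnit I (star A) ≠ 0 := by
  intro h0
  have h := evalUnit_mul_of_eq_zero hI A h0
  rw [Quaternion.star_mul_self, evalUnit_coe hI, sliceMap_eq_zero hI] at h
  exact hA h

/-- At a point `x + I y` of the reciprocal domain, where `f^c` takes the nonzero value `p`, the twist
is `x + (p⁻¹ I p) y`. -/
theorem IsInducedBy.twist_sliceMap (hΩ : IsOpen Ω) (hs : AxiallySymmetric Ω)
    (hf : IsInducedBy Ω f P) {I : ℍ} (hI : I ∈ imagUnits) {w : ℂ} (hw : w ∈ profile Ω)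
    (hn : Quaternion.normSq (P w) ≠ 0) :
    twist Ω f (sliceMap I w) =
      sliceMap ((evalUnit I (star (P w)))⁻¹ * I * evalUnit I (star (P w))) w := by
  rw [twist, (hf.regularConj hΩ hs).eq I hI w hw, conj_sliceMap (evalUnit_star_ne_zero hI hn)]

theorem IsInducedBy.regularConj_ne_zero (hΩ : IsOpen Ω) (hs : AxiallySymmetric Ω)
    (hf : IsInducedBy Ω f P) {q : ℍ} (hq : q ∈ reciprocalDomain Ω f) :
    SliceRegularity.regularConj Ω f q ≠ 0 := by
  obtain ⟨I, hI, w, hw, rfl⟩ := hs.exists_sliceMap (reciprocalDomain_subset hq)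
  obtain ⟨-, hn⟩ := (hf.sliceMap_mem_reciprocalDomain hΩ hs hI).1 hq
  rw [(hf.regularConj hΩ hs).eq I hI w hw]
  exact evalUnit_star_ne_zero hI hn

theorem IsInducedBy.twist_mem (hΩ : IsOpen Ω) (hs : AxiallySymmetric Ω)
    (hf : IsInducedBy Ω f P) {q : ℍ} (hq : q ∈ reciprocalDomain Ω f) :
    twist Ω f q ∈ reciprocalDomain Ω f := by
  obtain ⟨I, hI, w, hw, rfl⟩ := hs.exists_sliceMap (reciprocalDomain_subset hq)
  have hm := (hf.sliceMap_mem_reciprocalDomain hΩ hs hI).1 hq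
  rw [hf.twist_sliceMap hΩ hs hI hw hm.2]
  exact (hf.sliceMap_mem_reciprocalDomain hΩ hs
    (conj_mem_imagUnits hI (evalUnit_star_ne_zero hI hm.2))).2 hm

/-- The twisted product rule applied to `star P * P = normSq P`: the twisted unit it produces is
exactly that of `T_f`. -/
theorem IsInducedBy.regularConj_mul_apply_twist (hΩ : IsOpen Ω) (hs : AxiallySymmetric Ω)
    (hf : IsInducedBy Ω f P) {q : ℍ} (hq : q ∈ reciprocalDomain Ω f) :
    SliceRegularity.regularConj Ω f q * f (twist Ω f q) =
      SliceRegularity.symmetrization Ω f q := by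
  obtain ⟨I, hI, w, hw, rfl⟩ := hs.exists_sliceMap (reciprocalDomain_subset hq)
  obtain ⟨-, hn⟩ := (hf.sliceMap_mem_reciprocalDomain hΩ hs hI).1 hq
  have hp := evalUnit_star_ne_zero hI hn
  rw [hf.twist_sliceMap hΩ hs hI hw hn, hf.eq _ (conj_mem_imagUnits hI hp) w hw,
    (hf.regularConj hΩ hs).eq I hI w hw, ← evalUnit_mul_of_ne_zero hI _ hp,
    hf.symmetrization_sliceMap hΩ hs hI hw, Quaternion.star_mul_self, evalUnit_coe hI]

theorem IsInducedBy.apply_twist_ne_zero (hΩ : IsOpen Ω) (hs : AxiallySymmetric Ω)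
    (hf : IsInducedBy Ω f P) {q : ℍ} (hq : q ∈ reciprocalDomain Ω f) : f (twist Ω f q) ≠ 0 := by
  intro h0
  have h := hf.regularConj_mul_apply_twist hΩ hs hq
  rw [h0, mul_zero] at h
  exact hq.2 ⟨hq.1, h.symm⟩

theorem IsInducedBy.isStarProduct_starQuotient (hΩ : IsOpen Ω) (hs : AxiallySymmetric Ω)
    (hf : IsInducedBy Ω f P) (hg : IsInducedBy Ω g Q) :
    IsStarProduct (reciprocalDomain Ω f) (SliceRegularity.regularReciprocal Ω f) g
      (starQuotient Ω f g) :=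
  (hf.regularReciprocal hΩ hs).isStarProduct_starProduct (hf.isOpen_reciprocalDomain hΩ hs)
    (hf.axiallySymmetric_reciprocalDomain hΩ hs) (hg.mono reciprocalDomain_subset)

/-- The scalar `(normSq P)⁻¹` comes out untwisted, and `star P * Q` contributes `f^c(q) g(T_f q)`.
The prefactor `f^s(q)⁻¹ f^c(q)` is the inverse of `f(T_f q)`. -/
theorem IsInducedBy.starQuotient_apply (hΩ : IsOpen Ω) (hs : AxiallySymmetric Ω)
    (hf : IsInducedBy Ω f P) (hg : IsInducedBy Ω g Q) {q : ℍ} (hq : q ∈ reciprocalDomain Ω f) :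
    starQuotient Ω f g q = (f (twist Ω f q))⁻¹ * g (twist Ω f q) := by
  have hs' := hf.axiallySymmetric_reciprocalDomain hΩ hs
  have hquot := (hf.isStarProduct_starQuotient hΩ hs hg).isInducedBy hs'
    (hf.regularReciprocal hΩ hs) (hg.mono reciprocalDomain_subset)
  have hmul := hf.regularConj_mul_apply_twist hΩ hs hq
  have hne := hf.regularConj_ne_zero hΩ hs hq
  have hval : f (twist Ω f q) =
      (SliceRegularity.regularConj Ω f q)⁻¹ * SliceRegularity.symmetrization Ω f q := by
    rw [← hmul, inv_mul_cancel_left₀ hne]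
  rw [hval, mul_inv_rev, inv_inv]
  obtain ⟨I, hI, w, hw, rfl⟩ := hs.exists_sliceMap (reciprocalDomain_subset hq)
  obtain ⟨-, hn⟩ := (hf.sliceMap_mem_reciprocalDomain hΩ hs hI).1 hq
  have hp := evalUnit_star_ne_zero hI hn
  rw [hquot.eq I hI w ((hs'.mem_profile hI).2 hq), mul_assoc, evalUnit_coe_mul hI,
    evalUnit_mul_of_ne_zero hI _ hp, hf.twist_sliceMap hΩ hs hI hw hn,
    hg.eq _ (conj_mem_imagUnits hI hp) w hw, hf.symmetrization_sliceMap hΩ hs hI hw,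
    (hf.regularConj hΩ hs).eq I hI w hw, sliceMap_inv hI,
    mul_assoc (sliceMap I _)⁻¹]

theorem IsInducedBy.regularConj_regularConj (hΩ : IsOpen Ω) (hs : AxiallySymmetric Ω)
    (hf : IsInducedBy Ω f P) {q : ℍ} (hq : q ∈ Ω) :
    SliceRegularity.regularConj Ω (SliceRegularity.regularConj Ω f) q = f q := by
  obtain ⟨I, hI, w, hw, rfl⟩ := hs.exists_sliceMap hq
  rw [((hf.regularConj hΩ hs).regularConj hΩ hs).eq I hI w hw, star_star, hf.eq I hI w hw]

theorem IsInducedBy.reciprocalDomain_regularConj (hΩ : IsOpen Ω) (hs : AxiallySymmetric Ω)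
    (hf : IsInducedBy Ω f P) :
    reciprocalDomain Ω (SliceRegularity.regularConj Ω f) = reciprocalDomain Ω f := by
  ext q
  obtain ⟨I, hI, h⟩ := exists_sliceMap_eq q
  rw [← h, hf.sliceMap_mem_reciprocalDomain hΩ hs hI,
    (hf.regularConj hΩ hs).sliceMap_mem_reciprocalDomain hΩ hs hI, Quaternion.normSq_star]

theorem IsInducedBy.symmetrization_mul_comm (hΩ : IsOpen Ω) (hs : AxiallySymmetric Ω)
    (hf : IsInducedBy Ω f P) {q : ℍ} (hq : q ∈ Ω) :
    SliceRegularity.symmetrization Ω f q * q = q * SliceRegularity.symmetrization Ω f q := by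
  obtain ⟨I, hI, w, hw, rfl⟩ := hs.exists_sliceMap hq
  rw [hf.symmetrization_sliceMap hΩ hs hI hw, ← sliceMap_mul hI, ← sliceMap_mul hI, mul_comm]

/-- The second conjugation is by `f(T_f q) = p⁻¹ s`, where `p = f^c(q)` and `s = f^s(q)`. The factor
`p⁻¹` undoes the first conjugation, and `s` commutes with `q`. -/
theorem IsInducedBy.twist_regularConj_twist (hΩ : IsOpen Ω) (hs : AxiallySymmetric Ω)
    (hf : IsInducedBy Ω f P) {q : ℍ} (hq : q ∈ reciprocalDomain Ω f) :
    twist Ω (SliceRegularity.regularConj Ω f) (twist Ω f q) = q := by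
  have hmul := hf.regularConj_mul_apply_twist hΩ hs hq
  have hne := hf.regularConj_ne_zero hΩ hs hq
  have hcomm := hf.symmetrization_mul_comm hΩ hs hq.1
  have hs0 : SliceRegularity.symmetrization Ω f q ≠ 0 := fun h => hq.2 ⟨hq.1, h⟩
  rw [twist, hf.regularConj_regularConj hΩ hs (hf.twist_mem hΩ hs hq).1]
  have hval : f (twist Ω f q) =
      (SliceRegularity.regularConj Ω f q)⁻¹ * SliceRegularity.symmetrization Ω f q := by
    rw [← hmul, inv_mul_cancel_left₀ hne]
  rw [hval, twist]
  generalize SliceRegularity.regularConj Ω f q = p at *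
  generalize SliceRegularity.symmetrization Ω f q = s at *
  calc (p⁻¹ * s)⁻¹ * (p⁻¹ * q * p) * (p⁻¹ * s)
      = s⁻¹ * (p * p⁻¹) * q * (p * p⁻¹) * s := by
        rw [mul_inv_rev, inv_inv]; simp only [mul_assoc]
    _ = s⁻¹ * (s * q) := by rw [mul_inv_cancel₀ hne, mul_one, mul_one, mul_assoc, hcomm]
    _ = q := inv_mul_cancel_left₀ hs0 q

theorem IsInducedBy.twist_twist_regularConj (hΩ : IsOpen Ω) (hs : AxiallySymmetric Ω)
    (hf : IsInducedBy Ω f P) {q : ℍ} (hq : q ∈ reciprocalDomain Ω f) :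
    twist Ω f (twist Ω (SliceRegularity.regularConj Ω f) q) = q := by
  have hc := hf.regularConj hΩ hs
  rw [← hf.reciprocalDomain_regularConj hΩ hs] at hq
  have h := hc.twist_regularConj_twist hΩ hs hq
  have hq' := (hc.twist_mem hΩ hs hq).1
  -- `(f^c)^c` agrees with `f` only on `Ω`, so the replacement is made at one point after unfolding
  -- the twist.
  rwa [twist, hc.regularConj_regularConj hΩ hs hq'] at h

theorem IsInducedBy.contDiffOn_twist (hΩ : IsOpen Ω) (hs : AxiallySymmetric Ω)
    (hf : IsInducedBy Ω f P) : ContDiffOn ℝ ∞ (twist Ω f) (reciprocalDomain Ω f) :=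
  contDiffOn_quaternion_conj
    (((hf.regularConj hΩ hs).contDiffOn hΩ hs).mono reciprocalDomain_subset)
    fun _ hq => hf.regularConj_ne_zero hΩ hs hq

end reciprocal

end SliceRegularity

end

/-! ### The proposition -/

theorem mainTheorem11 (Ω : Set ℍ) (hΩ : SliceRegularity.IsSymmetricSliceDomain Ω)
    (f g : ℍ → ℍ) (hf : SliceRegularity.SliceRegular Ω f)
    (hg : SliceRegularity.SliceRegular Ω g) :
    -- the conjugate, the symmetrization, the reciprocal and the quotient are well defined
    (SliceRegularity.IsRegularConj Ω f (SliceRegularity.regularConj Ω f) ∧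
      SliceRegularity.IsStarProduct Ω f (SliceRegularity.regularConj Ω f)
        (SliceRegularity.symmetrization Ω f) ∧
      SliceRegularity.IsStarProduct Ω (SliceRegularity.regularConj Ω f) f
        (SliceRegularity.symmetrization Ω f) ∧
      SliceRegularity.SliceRegular (SliceRegularity.reciprocalDomain Ω f)
        (SliceRegularity.regularReciprocal Ω f) ∧
      SliceRegularity.IsStarProduct (SliceRegularity.reciprocalDomain Ω f)
        (SliceRegularity.regularReciprocal Ω f) g (SliceRegularity.starQuotient Ω f g)) ∧
    -- `T_f` is a well defined self-map of `Ω \ Z_{f^s}`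
    (∀ q ∈ SliceRegularity.reciprocalDomain Ω f,
      SliceRegularity.regularConj Ω f q ≠ 0 ∧
      SliceRegularity.twist Ω f q ∈ SliceRegularity.reciprocalDomain Ω f) ∧
    -- the formula for the quotient
    (∀ q ∈ SliceRegularity.reciprocalDomain Ω f,
      f (SliceRegularity.twist Ω f q) ≠ 0 ∧
      SliceRegularity.starQuotient Ω f g q =
        (f (SliceRegularity.twist Ω f q))⁻¹ * g (SliceRegularity.twist Ω f q)) ∧
    -- `T_{f^c}` has the same domain as `T_f` and is its two-sided inverse
    SliceRegularity.reciprocalDomain Ω (SliceRegularity.regularConj Ω f) =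
      SliceRegularity.reciprocalDomain Ω f ∧
    Set.MapsTo (SliceRegularity.twist Ω (SliceRegularity.regularConj Ω f))
      (SliceRegularity.reciprocalDomain Ω f) (SliceRegularity.reciprocalDomain Ω f) ∧
    Set.InvOn (SliceRegularity.twist Ω (SliceRegularity.regularConj Ω f))
      (SliceRegularity.twist Ω f)
      (SliceRegularity.reciprocalDomain Ω f) (SliceRegularity.reciprocalDomain Ω f) ∧
    -- `T_f` is a diffeomorphism of the open set `Ω \ Z_{f^s}` onto itself
    IsOpen (SliceRegularity.reciprocalDomain Ω f) ∧
    Set.BijOn (SliceRegularity.twist Ω f)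
      (SliceRegularity.reciprocalDomain Ω f) (SliceRegularity.reciprocalDomain Ω f) ∧
    ContDiffOn ℝ ∞ (SliceRegularity.twist Ω f) (SliceRegularity.reciprocalDomain Ω f) ∧
    ContDiffOn ℝ ∞ (SliceRegularity.twist Ω (SliceRegularity.regularConj Ω f))
      (SliceRegularity.reciprocalDomain Ω f) := by
  have ho := hΩ.isOpen
  have hs := hΩ.symmetric
  obtain ⟨P, hP⟩ := hf.exists_isInducedBy hΩ
  obtain ⟨Q, hQ⟩ := hg.exists_isInducedBy hΩ
  have hc := hP.regularConj ho hs
  have hdom := hP.reciprocalDomain_regularConj ho hs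
  have hmaps : Set.MapsTo (SliceRegularity.twist Ω (SliceRegularity.regularConj Ω f))
      (SliceRegularity.reciprocalDomain Ω f) (SliceRegularity.reciprocalDomain Ω f) := by
    rw [← hdom]
    exact fun q hq => hc.twist_mem ho hs hq
  have hinv : Set.InvOn (SliceRegularity.twist Ω (SliceRegularity.regularConj Ω f))
      (SliceRegularity.twist Ω f)
      (SliceRegularity.reciprocalDomain Ω f) (SliceRegularity.reciprocalDomain Ω f) :=
    ⟨fun q hq => hP.twist_regularConj_twist ho hs hq,
      fun q hq => hP.twist_twist_regularConj ho hs hq⟩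
  refine ⟨⟨hP.isRegularConj_regularConj ho hs, hP.isStarProduct_starProduct ho hs hc,
    hc.isStarProduct ho hs hP ?_,
    (hP.regularReciprocal ho hs).sliceRegular (hP.isOpen_reciprocalDomain ho hs)
      (hP.axiallySymmetric_reciprocalDomain ho hs),
    hP.isStarProduct_starQuotient ho hs hQ⟩,
    fun q hq => ⟨hP.regularConj_ne_zero ho hs hq, hP.twist_mem ho hs hq⟩,
    fun q hq => ⟨hP.apply_twist_ne_zero ho hs hq, hP.starQuotient_apply ho hs hQ hq⟩,
    hdom, hmaps, hinv, hP.isOpen_reciprocalDomain ho hs,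
    hinv.bijOn (fun q hq => hP.twist_mem ho hs hq) hmaps,
    hP.contDiffOn_twist ho hs, ?_⟩
  -- `P * star P` and `star P * P` are the same scalar `normSq P`, so `f^s` is also the product
  -- taken in the other order.
  · simpa only [Quaternion.star_mul_self] using hP.symmetrization ho hs
  · rw [← hdom]
    exact hc.contDiffOn_twist ho hs
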